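/- Let $\tau\in[0,1)$, $c\ge 0$ and $p\in\mathbb C$, and let $$Q_p(\zeta)=\frac{1}{1-\tau^2}\bigl(|\zeta|^2-\tau\,\mathrm{Re}\,\zeta^2\bigr)-2c\log|\zeta-p|,\qquad \zeta\in\mathbb C,$$ where $Q_p(p)=+\infty$ if $c>0$, and the logarithmic term is absent if $c=0$. For a compactly supported Borel probability measure $\mu$ on $\mathbb C$ put $$I_{Q_p}[\mu]=\iint_{\mathbb C^2}\log\frac{1}{|z-w|}\,d\mu(z)\,d\mu(w)+\int_{\mathbb C}Q_p\,d\mu\in(-\infty,+\infty].$$ Let $$S_1=\Bigl\{x+iy:\Bigl(\frac{x}{1+\tau}\Bigr)^2+\Bigl(\frac{y}{1-\tau}\Bigr)^2\le 1+c\Bigr\},\qquad S_2=\bigl\{x+iy:(x-\mathrm{Re}\,p)^2+(y-\mathrm{Im}\,p)^2\le(1-\tau^2)c\bigr\},$$ and suppose that $S_2\subset S_1$. Then there is exactly one compactly supported probability measure $\mu_{Q_p}$ that minimises $I_{Q_p}$ among all compactly supported probability measures (the equilibrium measure of $Q_p$), and its support, the droplet $S_{Q_p}$, is $$S_{Q_p}=S_1\cap(\mathrm{Int}\,S_2)^c.$$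 -/

import Mathlib

open MeasureTheory
open scoped ENNReal

noncomputable section

namespace PointCharge

/-- The integral of an extended-real function, as the integral of its positive part minus the
integral of its negative part. It is the usual value in `(-∞, ∞]` whenever the negative part has
finite integral. -/
def eintegral {α : Type*} [MeasurableSpace α] (μ : Measure α) (f : α → EReal) : EReal :=
  ((∫⁻ x, (f x).toENNReal ∂μ : ℝ≥0∞) : EReal) - ((∫⁻ x, (-f x).toENNReal ∂μ : ℝ≥0∞) : EReal)

/-- The logarithmic kernel `log (1 / |z - w|)`, equal to `+∞` on the diagonal. -/
def logKernel (z w : ℂ) : EReal := -ENNReal.log ‖z - w‖ₑ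

/-- The weighted logarithmic energy
`I_W[μ] = ∬ log (1 / |z - w|) dμ(z) dμ(w) + ∫ W dμ`.
For a compactly supported probability measure the kernel is bounded below almost everywhere, so the
double integral lies in `(-∞, ∞]`; if `W` is bounded below on compact sets, so does the second
integral. -/
def weightedEnergy (W : ℂ → EReal) (μ : Measure ℂ) : EReal :=
  eintegral (μ.prod μ) (fun q => logKernel q.1 q.2) + eintegral μ W

/-- `μ` is a compactly supported Borel probability measure on the plane. -/
def IsAdmissible (μ : Measure ℂ) : Prop :=
  IsProbabilityMeasure μ ∧ IsCompact μ.support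

/-- `μ` minimises the weighted logarithmic energy among all compactly supported probability
measures. -/
def IsEquilibriumMeasure (W : ℂ → EReal) (μ : Measure ℂ) : Prop :=
  IsAdmissible μ ∧ ∀ ν : Measure ℂ, IsAdmissible ν → weightedEnergy W μ ≤ weightedEnergy W ν

/-- `S` is the droplet of `W`: there is exactly one equilibrium measure associated with `W`, and
`S` is its support. -/
def IsDroplet (W : ℂ → EReal) (S : Set ℂ) : Prop :=
  (∃! μ : Measure ℂ, IsEquilibriumMeasure W μ) ∧
    ∀ μ : Measure ℂ, IsEquilibriumMeasure W μ → μ.support = S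

/-- The potential `Q_p(ζ) = (|ζ|² - τ Re ζ²) / (1 - τ²) - 2 c log |ζ - p|`; for `c > 0` its value
at `p` is `+∞`, and for `c = 0` the last term is absent. -/
def potential (τ c : ℝ) (p : ℂ) (ζ : ℂ) : EReal :=
  ((1 / (1 - τ ^ 2) * (‖ζ‖ ^ 2 - τ * (ζ ^ 2).re) : ℝ) : EReal)
    - ((2 * c : ℝ) : EReal) * ENNReal.log ‖ζ - p‖ₑ

/-- The closed elliptic region with semi-axes `(1 + τ) √(1 + c)` and `(1 - τ) √(1 + c)`. -/
def ellipseRegion (τ c : ℝ) : Set ℂ :=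
  {z | (z.re / (1 + τ)) ^ 2 + (z.im / (1 - τ)) ^ 2 ≤ 1 + c}

/-- The closed disc with centre `p` and radius `√((1 - τ²) c)` (the point `p` if `c = 0`). -/
def discRegion (τ c : ℝ) (p : ℂ) : Set ℂ :=
  {z | (z.re - p.re) ^ 2 + (z.im - p.im) ^ 2 ≤ (1 - τ ^ 2) * c}

end PointCharge

end

/-!
# The droplet of the elliptic Ginibre potential with a point charge

Put `k = √(1 + c)`, `r = √((1 - τ²) c)`, and let `μ` be the measure with constant density
`1 / (π (1 - τ²))` on the droplet, the ellipse `ellipseRegion τ c` without the open disc of centre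
`p` and radius `r`. The areas of ellipse and disc make `μ` a probability measure. Both regions being
uniformly charged, the logarithmic potential of `μ` is that of the ellipse minus that of the disc.

*Potential of an ellipse.* The ellipse is a union of homothetic ellipses, the images of the circles
`|w| = s` under `w ↦ w + τ w̄`. On such a circle `z - w - τ w̄` is, up to the factor `-1 / w`, a
quadratic polynomial in `w`, so Jensen's formula gives the average of `log |z - w - τ w̄|` in terms
of its roots (`ellipseAverage_eq`): it is `log s` if `z` is inside the ellipse, and `log |g|` with
`g` the larger root of `g + τ s² / g = z` if `z` is outside. As a function of `s`, `2 s log |g|` has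
the primitive `s² log |g| + (τ s⁴ / 2) Re g⁻²` (`integral_ellipseAverage`). Hence the potential of
the ellipse is a quadratic polynomial inside it (`integral_ellipseAverage_of_le`), and outside it is
controlled by `log n ≤ (n - n⁻¹) / 2`, `n ≥ 1` (`integral_ellipseAverage_le`). The disc is the case
`τ = 0`; outside it its potential is that of a point charge, inside it is weaker.

*Euler–Lagrange conditions.* Together these give `effectivePotential`: with
`U z = ∫ log |z - w| dμ w`, the function `Q_p - 2 U` is constant on the droplet and not smaller than
that constant elsewhere.

*Positivity.* By Frullani's integral, `-2 log |x| = ∫₀^∞ (exp (-t |x|²) - exp (-t)) dt / t`, and the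
Gaussian is the Fourier transform of a positive function. So the logarithmic energy of a difference
`ν - μ` of probability measures of finite energy is a superposition of weighted squared `L²` norms
of the difference of their characteristic functions; it is nonnegative and vanishes only if `ν = μ`
(`logEnergy_sub_nonneg`).

*Conclusion.* The excess energy of `ν` over `μ` is the logarithmic energy of `ν - μ` plus the
`ν`-integral of `Q_p - 2 U` minus its minimum, both nonnegative, and the first vanishes only for
`ν = μ` (`weightedEnergy_dropletMeasure_le`). Finally the support of `μ` is the whole droplet
(`support_dropletMeasure`), because the droplet is the closure of its interior even where the disc
touches the ellipse: the boundary of the ellipse does not lie on a circle near such a point.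
-/

noncomputable section

namespace PointCharge

open Filter Topology ComplexConjugate

/-! ### Frullani's integral for the logarithm -/

theorem integral_add_sub_sub {X E : Type*} [MeasurableSpace X] [NormedAddCommGroup E]
    [NormedSpace ℝ E] {m : Measure X} {f g h k : X → E} (hf : Integrable f m)
    (hg : Integrable g m) (hh : Integrable h m) (hk : Integrable k m) :
    ∫ x, (f x + g x - h x - k x) ∂m
      = (∫ x, f x ∂m) + (∫ x, g x ∂m) - (∫ x, h x ∂m) - ∫ x, k x ∂m := by
  rw [integral_sub (f := fun x => f x + g x - h x) ((hf.add hg).sub hh) hk,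
    integral_sub (f := fun x => f x + g x) (hf.add hg) hh, integral_add hf hg]

theorem integrableOn_inv_mul_exp_sub_exp {a : ℝ} (ha : 0 < a) :
    IntegrableOn (fun t : ℝ => t⁻¹ * (Real.exp (-(a * t)) - Real.exp (-(1 * t)))) (Set.Ioi 0) := by
  have hm : 0 < min a 1 := lt_min ha one_pos
  have hdom : IntegrableOn (fun t : ℝ => |a - 1| * Real.exp (-min a 1 * t)) (Set.Ioi 0) :=
    (exp_neg_integrableOn_Ioi 0 hm).const_mul _
  refine hdom.mono' (by fun_prop) ?_
  filter_upwards [ae_restrict_mem measurableSet_Ioi] with t ht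
  have ht : 0 < t := ht
  have key : ∀ x y : ℝ, x ≤ y → |Real.exp (-y) - Real.exp (-x)| ≤ (y - x) * Real.exp (-x) := by
    intro x y hxy
    rw [abs_sub_comm, abs_of_nonneg (sub_nonneg.2 (Real.exp_le_exp.2 (by linarith)))]
    have h1 := Real.add_one_le_exp (-(y - x))
    have h2 : Real.exp (-y) = Real.exp (-x) * Real.exp (-(y - x)) := by
      rw [← Real.exp_add]; ring_nf
    rw [h2]
    nlinarith [Real.exp_pos (-x)]
  rw [Real.norm_eq_abs, abs_mul, abs_of_pos (inv_pos.2 ht), inv_mul_le_iff₀ ht]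
  rcases le_total a 1 with h | h
  · have := key (a * t) (1 * t) (by nlinarith)
    rw [abs_sub_comm] at this
    rw [min_eq_left h, abs_sub_comm a 1, abs_of_nonneg (sub_nonneg.2 h)]
    refine this.trans_eq ?_
    ring_nf
  · have := key (1 * t) (a * t) (by nlinarith)
    rw [min_eq_right h, abs_of_nonneg (sub_nonneg.2 h)]
    refine this.trans_eq ?_
    ring_nf

theorem integral_inv_mul_exp_sub_exp {a : ℝ} (ha : 0 < a) :
    ∫ t in Set.Ioi (0 : ℝ), t⁻¹ * (Real.exp (-(a * t)) - Real.exp (-(1 * t))) = -Real.log a := by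
  have hc : Continuous fun x : ℝ => Real.exp (-x) := by fun_prop
  have h := Frullani.integral_Ioi_eq (f := fun x : ℝ => Real.exp (-x)) (a := a) (b := 1)
    (L := 1) (R := 0) (hc.locallyIntegrable.locallyIntegrableOn _) ha one_pos
    (by
      have := hc.tendsto 0
      simp only [neg_zero, Real.exp_zero] at this
      exact this.mono_left nhdsWithin_le_nhds)
    (Real.tendsto_exp_atBot.comp tendsto_neg_atTop_atBot)
    (integrableOn_inv_mul_exp_sub_exp ha)
  simpa using h

theorem integral_abs_inv_mul_exp_sub_exp {a : ℝ} (ha : 0 < a) :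
    ∫ t in Set.Ioi (0 : ℝ), ‖t⁻¹ * (Real.exp (-(a * t)) - Real.exp (-(1 * t)))‖
      = |Real.log a| := by
  have hI := integral_inv_mul_exp_sub_exp ha
  rcases le_total a 1 with h | h
  · rw [abs_of_nonpos (Real.log_nonpos ha.le h), ← hI]
    refine setIntegral_congr_fun measurableSet_Ioi fun t ht => ?_
    have ht : 0 < t := ht
    refine Real.norm_of_nonneg (mul_nonneg (inv_pos.2 ht).le (sub_nonneg.2 ?_))
    exact Real.exp_le_exp.2 (by nlinarith)
  · rw [abs_of_nonneg (Real.log_nonneg h), eq_comm, ← neg_eq_iff_eq_neg.2 hI, ← integral_neg]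
    refine setIntegral_congr_fun measurableSet_Ioi fun t ht => ?_
    have ht : 0 < t := ht
    refine (Real.norm_of_nonpos (mul_nonpos_of_nonneg_of_nonpos (inv_pos.2 ht).le
      (sub_nonpos.2 ?_))).symm
    exact Real.exp_le_exp.2 (by nlinarith)

/-! ### Strict positive definiteness of the logarithmic energy -/

/-- The mutual energy of `α` and `β` for the Gaussian kernel `exp (-t |z - w|²)`. -/
def gaussianEnergy (α β : Measure ℂ) (t : ℝ) : ℝ :=
  ∫ q, Real.exp (-(t * ‖q.1 - q.2‖ ^ 2)) ∂(α.prod β)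

theorem integrable_gaussianKernel (α β : Measure ℂ) [IsProbabilityMeasure α]
    [IsProbabilityMeasure β] {t : ℝ} (ht : 0 ≤ t) :
    Integrable (fun q : ℂ × ℂ => Real.exp (-(t * ‖q.1 - q.2‖ ^ 2))) (α.prod β) := by
  refine Integrable.mono' (integrable_const 1)
    (Continuous.aestronglyMeasurable (by fun_prop)) (Eventually.of_forall fun q => ?_)
  rw [Real.norm_of_nonneg (Real.exp_pos _).le, Real.exp_le_one_iff]
  have := mul_nonneg ht (sq_nonneg ‖q.1 - q.2‖)
  linarith

/-- Integrating Frullani's formula for `log |z - w|²` against `α ⊗ β` writes the logarithmic energy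
as a superposition of Gaussian energies. -/
theorem logEnergy_eq_integral_gaussianEnergy (α β : Measure ℂ) [IsProbabilityMeasure α]
    [IsProbabilityMeasure β]
    (hint : Integrable (fun q : ℂ × ℂ => Real.log ‖q.1 - q.2‖) (α.prod β))
    (hne : ∀ᵐ q ∂(α.prod β), q.1 ≠ q.2) :
    IntegrableOn (fun t : ℝ => t⁻¹ * (gaussianEnergy α β t - Real.exp (-(1 * t)))) (Set.Ioi 0) ∧
    ∫ t in Set.Ioi (0 : ℝ), t⁻¹ * (gaussianEnergy α β t - Real.exp (-(1 * t)))
      = -2 * ∫ q, Real.log ‖q.1 - q.2‖ ∂(α.prod β) := by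
  set G : (ℂ × ℂ) × ℝ → ℝ := fun x =>
    x.2⁻¹ * (Real.exp (-(‖x.1.1 - x.1.2‖ ^ 2 * x.2)) - Real.exp (-(1 * x.2))) with hG
  have hpos : ∀ᵐ q ∂(α.prod β), 0 < ‖q.1 - q.2‖ ^ 2 := by
    filter_upwards [hne] with q hq
    have := norm_pos_iff.2 (sub_ne_zero.2 hq)
    positivity
  have hGi : Integrable G ((α.prod β).prod (volume.restrict (Set.Ioi 0))) := by
    rw [integrable_prod_iff (by fun_prop)]
    constructor
    · filter_upwards [hpos] with q hq using integrableOn_inv_mul_exp_sub_exp hq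
    · refine (hint.norm.const_mul 2).congr ?_
      filter_upwards [hpos] with q hq
      rw [integral_abs_inv_mul_exp_sub_exp hq, Real.log_pow, abs_mul]
      simp
  have hinner : ∀ t ∈ Set.Ioi (0 : ℝ), ∫ q, G (q, t) ∂(α.prod β)
      = t⁻¹ * (gaussianEnergy α β t - Real.exp (-(1 * t))) := by
    intro t ht
    have h1 := integrable_gaussianKernel α β (le_of_lt ht)
    simp only [hG]
    rw [integral_const_mul, integral_sub (by simpa only [mul_comm t] using h1)
      (integrable_const _)]
    simp [gaussianEnergy, mul_comm t]
  constructor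
  · refine (hGi.integral_prod_right).congr ?_
    filter_upwards [ae_restrict_mem measurableSet_Ioi] with t ht using hinner t ht
  · rw [← setIntegral_congr_fun measurableSet_Ioi hinner,
      integral_integral_swap (f := fun t q => G (q, t)) hGi.swap,
      ← integral_const_mul]
    refine integral_congr_ae ?_
    filter_upwards [hpos] with q hq
    simp only [hG]
    rw [integral_inv_mul_exp_sub_exp hq, Real.log_pow]
    push_cast
    ring

/-- The Gaussian is the Fourier transform of a Gaussian, normalised by `4 π t` in real
dimension two. -/
theorem gaussian_eq_integral {t : ℝ} (ht : 0 < t) (x : ℂ) :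
    ((Real.exp (-(t * ‖x‖ ^ 2)) : ℝ) : ℂ) = (4 * Real.pi * t : ℂ)⁻¹ *
      ∫ v : ℂ, Complex.exp (-((4 * t : ℝ) : ℂ)⁻¹ * ‖v‖ ^ 2 + Complex.I * inner ℝ x v) := by
  have h := GaussianFourier.integral_cexp_neg_mul_sq_norm_add
    (V := ℂ) (b := ((4 * t : ℝ) : ℂ)⁻¹)
    (by rw [← Complex.ofReal_inv, Complex.ofReal_re]; positivity) Complex.I x
  rw [h]
  have ht' : (t : ℂ) ≠ 0 := by exact_mod_cast ht.ne'
  have hpi : (Real.pi : ℂ) ≠ 0 := by exact_mod_cast Real.pi_ne_zero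
  rw [Complex.finrank_real_complex]
  push_cast
  rw [div_self two_ne_zero, Complex.cpow_one, ← mul_assoc]
  rw [show (4 * (Real.pi : ℂ) * t)⁻¹ * (Real.pi / (4 * (t : ℂ))⁻¹) = 1 by field_simp, one_mul]
  congr 1
  rw [Complex.I_sq]
  field_simp

theorem integrable_gaussian {t : ℝ} (ht : 0 < t) :
    Integrable (fun v : ℂ => Real.exp (-(4 * t)⁻¹ * ‖v‖ ^ 2)) := by
  have h := GaussianFourier.integrable_cexp_neg_mul_sq_norm_add (V := ℂ)
    (b := ((4 * t : ℝ) : ℂ)⁻¹)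
    (by rw [← Complex.ofReal_inv, Complex.ofReal_re]; positivity) 0 0
  refine h.norm.congr (Eventually.of_forall fun v => ?_)
  simp only [Complex.norm_exp]
  congr 1
  simp [← Complex.ofReal_pow, ← Complex.ofReal_mul, ← Complex.ofReal_inv]

theorem gaussianEnergy_eq_integral_charFun (α β : Measure ℂ) [IsProbabilityMeasure α]
    [IsProbabilityMeasure β] {t : ℝ} (ht : 0 < t) :
    (gaussianEnergy α β t : ℂ) = (4 * Real.pi * t : ℂ)⁻¹ *
      ∫ v : ℂ, (Real.exp (-(4 * t)⁻¹ * ‖v‖ ^ 2) : ℂ) * (charFun α v * conj (charFun β v)) := by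
  rw [gaussianEnergy, ← integral_complex_ofReal]
  simp_rw [gaussian_eq_integral ht]
  rw [integral_const_mul]
  congr 1
  set F : ℂ × ℂ → ℂ → ℂ := fun q v =>
    Complex.exp (-((4 * t : ℝ) : ℂ)⁻¹ * ‖v‖ ^ 2 + Complex.I * inner ℝ (q.1 - q.2) v) with hF
  have hnorm : ∀ q v, ‖F q v‖ = Real.exp (-(4 * t)⁻¹ * ‖v‖ ^ 2) := by
    intro q v
    simp only [hF, Complex.norm_exp]
    congr 1
    simp [← Complex.ofReal_pow, ← Complex.ofReal_mul, ← Complex.ofReal_inv]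
  have hFi : Integrable (Function.uncurry F) ((α.prod β).prod volume) := by
    rw [← integrable_norm_iff (Continuous.aestronglyMeasurable (by fun_prop))]
    refine ((integrable_gaussian ht).comp_snd (α.prod β)).congr
      (Eventually.of_forall fun x => ?_)
    exact (hnorm x.1 x.2).symm
  rw [integral_integral_swap hFi]
  refine integral_congr_ae (Eventually.of_forall fun v => ?_)
  simp only
  have hsplit : ∀ q : ℂ × ℂ, F q v = ((Real.exp (-(4 * t)⁻¹ * ‖v‖ ^ 2) : ℝ) : ℂ) *
      (Complex.exp (inner ℝ q.1 v * Complex.I) * Complex.exp (inner ℝ q.2 (-v) * Complex.I)) := by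
    intro q
    simp only [hF]
    rw [Complex.ofReal_exp, ← Complex.exp_add, ← Complex.exp_add, inner_sub_left, inner_neg_right]
    congr 1
    push_cast
    ring
  simp_rw [hsplit]
  rw [integral_const_mul, integral_prod_mul (fun z : ℂ => Complex.exp (inner ℝ z v * Complex.I))
    (fun w : ℂ => Complex.exp (inner ℝ w (-v) * Complex.I)), ← charFun_apply, ← charFun_apply,
    charFun_neg]

/-- The Gaussian kernel is positive definite: the Gaussian energy of `ν - μ` is a weighted `L²` norm
of the difference of the characteristic functions. -/
theorem gaussianEnergy_sub (ν μ : Measure ℂ) [IsProbabilityMeasure ν]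
    [IsProbabilityMeasure μ] {t : ℝ} (ht : 0 < t) :
    gaussianEnergy ν ν t + gaussianEnergy μ μ t - gaussianEnergy ν μ t - gaussianEnergy μ ν t
      = (4 * Real.pi * t)⁻¹ *
        ∫ v : ℂ, Real.exp (-(4 * t)⁻¹ * ‖v‖ ^ 2) * ‖charFun ν v - charFun μ v‖ ^ 2 := by
  have hi : ∀ (α β : Measure ℂ) [IsProbabilityMeasure α] [IsProbabilityMeasure β],
      Integrable (fun v : ℂ =>
        (Real.exp (-(4 * t)⁻¹ * ‖v‖ ^ 2) : ℂ) * (charFun α v * conj (charFun β v))) := by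
    intro α β _ _
    refine (integrable_gaussian ht).mono' ?_ (Eventually.of_forall fun v => ?_)
    · exact (Continuous.aestronglyMeasurable (by fun_prop)).mul
        (measurable_charFun.aestronglyMeasurable.mul
          (Complex.continuous_conj.measurable.comp measurable_charFun).aestronglyMeasurable)
    · rw [norm_mul, norm_mul, RCLike.norm_conj, Complex.norm_real,
        Real.norm_of_nonneg (Real.exp_pos _).le]
      refine mul_le_of_le_one_right (Real.exp_pos _).le ?_
      exact mul_le_one₀ (norm_charFun_le_one _) (norm_nonneg _) (norm_charFun_le_one _)
  rw [← Complex.ofReal_inj]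
  push_cast
  rw [gaussianEnergy_eq_integral_charFun ν ν ht, gaussianEnergy_eq_integral_charFun μ μ ht,
    gaussianEnergy_eq_integral_charFun ν μ ht, gaussianEnergy_eq_integral_charFun μ ν ht,
    ← integral_complex_ofReal, ← mul_add, ← mul_sub, ← mul_sub,
    ← integral_add_sub_sub (hi _ _) (hi _ _) (hi _ _) (hi _ _)]
  congr 1
  refine integral_congr_ae (Eventually.of_forall fun v => ?_)
  push_cast
  rw [← Complex.mul_conj' (charFun ν v - charFun μ v), map_sub]
  ring

/-- Strict positive definiteness of the logarithmic kernel on neutral charges: the logarithmic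
energy of `ν - μ` is nonnegative, and vanishes only if `ν = μ`. -/
theorem logEnergy_sub_nonneg (ν μ : Measure ℂ) [IsProbabilityMeasure ν]
    [IsProbabilityMeasure μ]
    (hνν : Integrable (fun q : ℂ × ℂ => Real.log ‖q.1 - q.2‖) (ν.prod ν))
    (hμμ : Integrable (fun q : ℂ × ℂ => Real.log ‖q.1 - q.2‖) (μ.prod μ))
    (hνμ : Integrable (fun q : ℂ × ℂ => Real.log ‖q.1 - q.2‖) (ν.prod μ))
    (dνν : ∀ᵐ q ∂(ν.prod ν), q.1 ≠ q.2) (dμμ : ∀ᵐ q ∂(μ.prod μ), q.1 ≠ q.2)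
    (dνμ : ∀ᵐ q ∂(ν.prod μ), q.1 ≠ q.2) :
    (∫ q, Real.log ‖q.1 - q.2‖ ∂(ν.prod ν)) + (∫ q, Real.log ‖q.1 - q.2‖ ∂(μ.prod μ))
      ≤ 2 * ∫ q, Real.log ‖q.1 - q.2‖ ∂(ν.prod μ) ∧
    ((∫ q, Real.log ‖q.1 - q.2‖ ∂(ν.prod ν)) + (∫ q, Real.log ‖q.1 - q.2‖ ∂(μ.prod μ))
      = 2 * ∫ q, Real.log ‖q.1 - q.2‖ ∂(ν.prod μ) → ν = μ) := by
  have hsymm : ∀ q : ℂ × ℂ, Real.log ‖q.swap.1 - q.swap.2‖ = Real.log ‖q.1 - q.2‖ := fun q => by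
    rw [Prod.fst_swap, Prod.snd_swap, norm_sub_rev]
  have hμν : Integrable (fun q : ℂ × ℂ => Real.log ‖q.1 - q.2‖) (μ.prod ν) :=
    hνμ.swap.congr (Eventually.of_forall hsymm)
  have dμν : ∀ᵐ q ∂(μ.prod ν), q.1 ≠ q.2 := by
    rw [← Measure.prod_swap] at dνμ
    have := ae_of_ae_map measurable_swap.aemeasurable dνμ
    filter_upwards [this] with q hq using hq.symm
  have hsw : ∫ q, Real.log ‖q.1 - q.2‖ ∂(μ.prod ν) = ∫ q, Real.log ‖q.1 - q.2‖ ∂(ν.prod μ) := by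
    rw [← integral_prod_swap]
    exact integral_congr_ae (Eventually.of_forall hsymm)
  obtain ⟨i1, e1⟩ := logEnergy_eq_integral_gaussianEnergy ν ν hνν dνν
  obtain ⟨i2, e2⟩ := logEnergy_eq_integral_gaussianEnergy μ μ hμμ dμμ
  obtain ⟨i3, e3⟩ := logEnergy_eq_integral_gaussianEnergy ν μ hνμ dνμ
  obtain ⟨i4, e4⟩ := logEnergy_eq_integral_gaussianEnergy μ ν hμν dμν
  rw [hsw] at e4
  -- the terms `exp (-t)` that make the integrals converge cancel, as the total charge is zero
  set K : ℝ → ℝ := fun t => t⁻¹ * ((4 * Real.pi * t)⁻¹ *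
        ∫ v : ℂ, Real.exp (-(4 * t)⁻¹ * ‖v‖ ^ 2) * ‖charFun ν v - charFun μ v‖ ^ 2) with hK
  have hKeq : ∀ t ∈ Set.Ioi (0 : ℝ),
      t⁻¹ * (gaussianEnergy ν ν t - Real.exp (-(1 * t)))
        + t⁻¹ * (gaussianEnergy μ μ t - Real.exp (-(1 * t)))
        - t⁻¹ * (gaussianEnergy ν μ t - Real.exp (-(1 * t)))
        - t⁻¹ * (gaussianEnergy μ ν t - Real.exp (-(1 * t))) = K t := by
    intro t ht
    simp only [hK]
    rw [← gaussianEnergy_sub ν μ ht]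
    ring
  have hKi : IntegrableOn K (Set.Ioi 0) := by
    refine ((((i1.add i2).sub i3).sub i4)).congr ?_
    filter_upwards [ae_restrict_mem measurableSet_Ioi] with t ht using hKeq t ht
  have hKint : ∫ t in Set.Ioi (0 : ℝ), K t =
      2 * (2 * (∫ q, Real.log ‖q.1 - q.2‖ ∂(ν.prod μ)) - (∫ q, Real.log ‖q.1 - q.2‖ ∂(ν.prod ν))
        - ∫ q, Real.log ‖q.1 - q.2‖ ∂(μ.prod μ)) := by
    rw [← setIntegral_congr_fun measurableSet_Ioi hKeq, integral_add_sub_sub i1 i2 i3 i4,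
      e1, e2, e3, e4]
    ring
  have hK0 : ∀ t ∈ Set.Ioi (0 : ℝ), 0 ≤ K t := by
    intro t ht
    have ht : 0 < t := ht
    have : 0 ≤ ∫ v : ℂ, Real.exp (-(4 * t)⁻¹ * ‖v‖ ^ 2) * ‖charFun ν v - charFun μ v‖ ^ 2 :=
      integral_nonneg fun v => by positivity
    simp only [hK]
    positivity
  have hK0' : 0 ≤ᵐ[volume.restrict (Set.Ioi (0 : ℝ))] K := by
    filter_upwards [ae_restrict_mem measurableSet_Ioi] with t ht using hK0 t ht
  constructor
  · have := integral_nonneg_of_ae hK0'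
    linarith
  · intro heq
    have hz : ∫ t in Set.Ioi (0 : ℝ), K t = 0 := by rw [hKint]; linarith
    have hKae := (integral_eq_zero_iff_of_nonneg_ae hK0' hKi).1 hz
    -- a single time at which the Gaussian energy of `ν - μ` vanishes is enough
    obtain ⟨t, htK, ht⟩ : ∃ t, K t = 0 ∧ t ∈ Set.Ioi (0 : ℝ) := by
      have : NeBot (ae (volume.restrict (Set.Ioi (0 : ℝ)))) := by
        rw [ae_neBot, Ne, Measure.restrict_eq_zero]; simp
      exact (hKae.and (ae_restrict_mem measurableSet_Ioi)).exists
    have ht : 0 < t := ht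
    have hc : ∀ (α : Measure ℂ) [IsProbabilityMeasure α], Continuous (charFun α) := by
      intro α _
      exact continuous_charFun
    have hcont : Continuous fun v : ℂ =>
        Real.exp (-(4 * t)⁻¹ * ‖v‖ ^ 2) * ‖charFun ν v - charFun μ v‖ ^ 2 := by
      have := hc ν
      have := hc μ
      fun_prop
    have hvi : Integrable fun v : ℂ =>
        Real.exp (-(4 * t)⁻¹ * ‖v‖ ^ 2) * ‖charFun ν v - charFun μ v‖ ^ 2 := by
      refine ((integrable_gaussian ht).mul_const 4).mono' hcont.aestronglyMeasurable
        (Eventually.of_forall fun v => ?_)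
      rw [Real.norm_of_nonneg (by positivity)]
      refine mul_le_mul_of_nonneg_left ?_ (Real.exp_pos _).le
      have h2 : ‖charFun ν v - charFun μ v‖ ≤ 2 :=
        (norm_sub_le _ _).trans (by
          have := norm_charFun_le_one (μ := ν) v
          have := norm_charFun_le_one (μ := μ) v
          linarith)
      nlinarith [norm_nonneg (charFun ν v - charFun μ v)]
    have hv0 : ∫ v : ℂ, Real.exp (-(4 * t)⁻¹ * ‖v‖ ^ 2) * ‖charFun ν v - charFun μ v‖ ^ 2 = 0 := by
      simp only [hK] at htK
      have h4 : (4 * Real.pi * t)⁻¹ ≠ 0 := by positivity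
      exact (mul_eq_zero.1 ((mul_eq_zero.1 htK).resolve_left (inv_ne_zero ht.ne'))).resolve_left h4
    have hae := (integral_eq_zero_iff_of_nonneg (fun v => by positivity) hvi).1 hv0
    have hall := (hcont.ae_eq_iff_eq volume continuous_const).1 hae
    refine Measure.ext_of_charFun (funext fun v => ?_)
    have hv := (mul_eq_zero.1 (congrFun hall v)).resolve_left (Real.exp_pos _).ne'
    exact sub_eq_zero.1 (norm_eq_zero.1 (eq_zero_of_pow_eq_zero hv))

/-! ### Polar coordinates on a disc -/

theorem polarCoord_symm_mem_ball_iff {p : ℝ × ℝ} (hp : p ∈ polarCoord.target) {R : ℝ} :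
    Complex.polarCoord.symm p ∈ Metric.ball (0 : ℂ) R ↔
      p ∈ Set.Ioo 0 R ×ˢ Set.Ioo (-Real.pi) Real.pi := by
  rw [polarCoord_target] at hp
  have h0 : 0 < p.1 := hp.1
  rw [mem_ball_zero_iff, Complex.norm_polarCoord_symm, abs_of_pos h0]
  exact ⟨fun h => ⟨⟨h0, h⟩, hp.2⟩, fun h => h.1.2⟩

theorem Ioo_prod_Ioo_subset_polarCoord_target (R : ℝ) :
    Set.Ioo 0 R ×ˢ Set.Ioo (-Real.pi) Real.pi ⊆ polarCoord.target := by
  rw [polarCoord_target]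
  exact Set.prod_mono Set.Ioo_subset_Ioi_self subset_rfl

theorem setIntegral_ball_eq_polar {f : ℂ → ℝ} {R : ℝ} :
    ∫ w in Metric.ball (0 : ℂ) R, f w
      = ∫ p in Set.Ioo 0 R ×ˢ Set.Ioo (-Real.pi) Real.pi, p.1 * f (Complex.polarCoord.symm p) := by
  rw [← integral_indicator Metric.isOpen_ball.measurableSet,
    ← Complex.integral_comp_polarCoord_symm,
    ← integral_indicator polarCoord.open_target.measurableSet,
    ← integral_indicator (measurableSet_Ioo.prod measurableSet_Ioo)]
  congr 1
  ext p
  by_cases hp : p ∈ polarCoord.target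
  · have hiff := polarCoord_symm_mem_ball_iff hp (R := R)
    by_cases hR : Complex.polarCoord.symm p ∈ Metric.ball (0 : ℂ) R
    · rw [Set.indicator_of_mem hp, Set.indicator_of_mem hR, Set.indicator_of_mem (hiff.1 hR),
        smul_eq_mul]
    · rw [Set.indicator_of_mem hp, Set.indicator_of_notMem hR,
        Set.indicator_of_notMem (hiff.not.1 hR), smul_zero]
  · rw [Set.indicator_of_notMem hp,
      Set.indicator_of_notMem fun h => hp (Ioo_prod_Ioo_subset_polarCoord_target R h)]

theorem setLIntegral_ball_eq_polar {f : ℂ → ℝ≥0∞} {R : ℝ} :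
    ∫⁻ w in Metric.ball (0 : ℂ) R, f w
      = ∫⁻ p in Set.Ioo 0 R ×ˢ Set.Ioo (-Real.pi) Real.pi,
          ENNReal.ofReal p.1 * f (Complex.polarCoord.symm p) := by
  rw [← lintegral_indicator Metric.isOpen_ball.measurableSet,
    ← Complex.lintegral_comp_polarCoord_symm,
    ← lintegral_indicator polarCoord.open_target.measurableSet,
    ← lintegral_indicator (measurableSet_Ioo.prod measurableSet_Ioo)]
  congr 1
  ext p
  by_cases hp : p ∈ polarCoord.target
  · have hiff := polarCoord_symm_mem_ball_iff hp (R := R)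
    by_cases hR : Complex.polarCoord.symm p ∈ Metric.ball (0 : ℂ) R
    · rw [Set.indicator_of_mem hp, Set.indicator_of_mem hR, Set.indicator_of_mem (hiff.1 hR),
        smul_eq_mul]
    · rw [Set.indicator_of_mem hp, Set.indicator_of_notMem hR,
        Set.indicator_of_notMem (hiff.not.1 hR), smul_zero]
  · rw [Set.indicator_of_notMem hp,
      Set.indicator_of_notMem fun h => hp (Ioo_prod_Ioo_subset_polarCoord_target R h)]

theorem integrableOn_ball_iff_polar {f : ℂ → ℝ} (hf : Measurable f) {R : ℝ} :
    IntegrableOn f (Metric.ball (0 : ℂ) R) ↔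
      IntegrableOn (fun p : ℝ × ℝ => p.1 * f (Complex.polarCoord.symm p))
        (Set.Ioo 0 R ×ˢ Set.Ioo (-Real.pi) Real.pi) := by
  have hm : Measurable (fun p : ℝ × ℝ => p.1 * f (Complex.polarCoord.symm p)) := by
    simp only [Complex.polarCoord_symm_apply]
    fun_prop
  have e : ∫⁻ w in Metric.ball (0 : ℂ) R, ‖f w‖ₑ
      = ∫⁻ p in Set.Ioo 0 R ×ˢ Set.Ioo (-Real.pi) Real.pi,
        ‖p.1 * f (Complex.polarCoord.symm p)‖ₑ := by
    rw [setLIntegral_ball_eq_polar]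
    refine setLIntegral_congr_fun (measurableSet_Ioo.prod measurableSet_Ioo) fun p hp => ?_
    have h0 : 0 < p.1 := hp.1.1
    rw [enorm_mul, Real.enorm_of_nonneg h0.le]
  simp only [IntegrableOn, Integrable, hf.aestronglyMeasurable, hm.aestronglyMeasurable, true_and,
    hasFiniteIntegral_iff_enorm, e]

/-- Integration over a disc in polar coordinates, the angular integral being written as a circle
average. -/
theorem setIntegral_ball_eq_circleAverage {f : ℂ → ℝ} (hf : Measurable f) {R : ℝ} (hR : 0 ≤ R)
    (hi : IntegrableOn f (Metric.ball (0 : ℂ) R)) :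
    ∫ w in Metric.ball (0 : ℂ) R, f w
      = Real.pi * ∫ s in (0 : ℝ)..R, 2 * s * Real.circleAverage f 0 s := by
  rw [integrableOn_ball_iff_polar hf] at hi
  rw [setIntegral_ball_eq_polar, Measure.volume_eq_prod, setIntegral_prod _ hi,
    intervalIntegral.integral_of_le hR, integral_Ioc_eq_integral_Ioo, ← integral_const_mul]
  refine setIntegral_congr_fun measurableSet_Ioo fun s hs => ?_
  simp only
  rw [integral_const_mul, ← integral_Ioc_eq_integral_Ioo, ← intervalIntegral.integral_of_le
    (by linarith [Real.pi_pos]), Real.circleAverage, smul_eq_mul]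
  have hper : Function.Periodic (fun θ => f (circleMap 0 s θ)) (2 * Real.pi) :=
    (periodic_circleMap 0 s).comp f
  have h1 := hper.intervalIntegral_add_eq (-Real.pi) 0
  rw [zero_add, show -Real.pi + 2 * Real.pi = Real.pi by ring] at h1
  rw [← h1]
  have h2 : ∀ θ : ℝ, f (Complex.polarCoord.symm (s, θ)) = f (circleMap 0 s θ) := fun θ => by
    rw [Complex.polarCoord_symm_apply, circleMap_zero, Complex.exp_mul_I]
    push_cast
    rfl
  simp_rw [h2]
  have := Real.pi_pos
  field_simp

theorem integrableOn_log_norm_ball (R : ℝ) :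
    IntegrableOn (fun w : ℂ => Real.log ‖w‖) (Metric.ball (0 : ℂ) R) := by
  rw [integrableOn_ball_iff_polar (by fun_prop)]
  have hc : Continuous fun p : ℝ × ℝ => p.1 * Real.log p.1 :=
    Real.continuous_mul_log.comp continuous_fst
  have hK : IsCompact (Set.Icc (0 : ℝ) R ×ˢ Set.Icc (-Real.pi) Real.pi) :=
    isCompact_Icc.prod isCompact_Icc
  refine ((hc.continuousOn.integrableOn_compact hK).mono_set
    (Set.prod_mono Set.Ioo_subset_Icc_self Set.Ioo_subset_Icc_self)).congr ?_
  filter_upwards [ae_restrict_mem (measurableSet_Ioo.prod measurableSet_Ioo)] with p hp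
  have h0 : 0 < p.1 := hp.1.1
  rw [Complex.norm_polarCoord_symm, abs_of_pos h0]

/-! ### Averages of the logarithm over homothetic ellipses -/

/-- The real-linear map `ζ ↦ ζ + τ ζ̄`; it maps the unit circle onto the ellipse with semi-axes
`1 + τ` and `1 - τ`. -/
def ellipseMap (τ : ℝ) (ζ : ℂ) : ℂ := ζ + τ * conj ζ

/-- The quadratic form `(x / (1 + τ))² + (y / (1 - τ))²`, the square of the gauge of the ellipse
with semi-axes `1 + τ` and `1 - τ`. -/
def ellipseGauge (τ : ℝ) (z : ℂ) : ℝ := (z.re / (1 + τ)) ^ 2 + (z.im / (1 - τ)) ^ 2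

/-- The mean value of `w ↦ log |z - w|` over the ellipse that is the image under `ellipseMap τ` of
the circle of radius `s`, with respect to the angle on that circle. -/
def ellipseAverage (τ s : ℝ) (z : ℂ) : ℝ :=
  Real.circleAverage (fun w => Real.log ‖z - ellipseMap τ w‖) 0 s

theorem exists_add_eq_mul_eq (z m : ℂ) : ∃ g h : ℂ, g + h = z ∧ g * h = m ∧ ‖h‖ ≤ ‖g‖ := by
  obtain ⟨d, hd⟩ := IsAlgClosed.exists_pow_nat_eq (z ^ 2 - 4 * m) (n := 2) two_pos
  rcases le_total ‖(z - d) / 2‖ ‖(z + d) / 2‖ with h | h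
  · exact ⟨_, _, by ring, by linear_combination (-1 / 4 : ℂ) * hd, h⟩
  · exact ⟨_, _, by ring, by linear_combination (-1 / 4 : ℂ) * hd, h⟩

/-- On the circle `|w| = s` the equation `z = w + τ w̄` becomes quadratic in `w`; the average of
the logarithm is then a sum over its two roots, by Jensen's formula. -/
theorem ellipseAverage_eq {τ s : ℝ} (hs : 0 < s) {z g h : ℂ} (hadd : g + h = z)
    (hmul : g * h = τ * s ^ 2) :
    ellipseAverage τ s z
      = Real.log s + Real.posLog (s⁻¹ * ‖g‖) + Real.posLog (s⁻¹ * ‖h‖) := by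
  have e : ellipseAverage τ s z = Real.circleAverage
      (fun w => Real.log ‖w - g‖ + Real.log ‖w - h‖ - Real.log s) 0 s := by
    refine Real.circleAverage_congr_codiscreteWithin ?_ hs.ne'
    have hfin : ({g, h} : Set ℂ)ᶜ ∈ codiscreteWithin (Metric.sphere (0 : ℂ) |s|) :=
      compl_finite_mem_codiscreteWithin (Set.toFinite _)
    filter_upwards [hfin, self_mem_codiscreteWithin _] with w hw hws
    have hw1 : w ≠ g := fun h => hw (by simp [h])
    have hw2 : w ≠ h := fun h => hw (by simp [h])
    have hn : ‖w‖ = s := by simpa [abs_of_pos hs] using hws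
    have hw0 : w ≠ 0 := norm_pos_iff.1 (hn ▸ hs)
    have h1 : w * conj w = (s : ℂ) ^ 2 := by rw [Complex.mul_conj', hn]
    have h2 : w * (z - ellipseMap τ w) = -((w - g) * (w - h)) := by
      unfold ellipseMap
      linear_combination (-(τ : ℂ)) * h1 + hmul - w * hadd
    have h3 : ‖z - ellipseMap τ w‖ = ‖w - g‖ * ‖w - h‖ / s := by
      rw [eq_div_iff hs.ne', ← norm_mul, ← norm_neg ((w - g) * (w - h)), ← h2, norm_mul, hn,
        mul_comm]
    have p1 : ‖w - g‖ ≠ 0 := norm_ne_zero_iff.2 (sub_ne_zero.2 hw1)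
    have p2 : ‖w - h‖ ≠ 0 := norm_ne_zero_iff.2 (sub_ne_zero.2 hw2)
    rw [h3, Real.log_div (mul_ne_zero p1 p2) hs.ne', Real.log_mul p1 p2]
  have c1 := circleIntegrable_log_norm_sub_const (a := g) (c := 0) s
  have c2 := circleIntegrable_log_norm_sub_const (a := h) (c := 0) s
  rw [e]
  have a1 := Real.circleAverage_sub (f₁ := fun w => Real.log ‖w - g‖ + Real.log ‖w - h‖)
    (f₂ := fun _ => Real.log s) (c := 0) (R := s) (c1.add c2) (circleIntegrable_const _ _ _)
  have a2 := Real.circleAverage_add (f₁ := fun w => Real.log ‖w - g‖)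
    (f₂ := fun w => Real.log ‖w - h‖) c1 c2
  rw [Real.circleAverage_const] at a1
  refine a1.trans ?_
  rw [show (fun w : ℂ => Real.log ‖w - g‖ + Real.log ‖w - h‖)
    = (fun w => Real.log ‖w - g‖) + fun w => Real.log ‖w - h‖ from rfl, a2,
    circleAverage_log_norm_sub_const_eq_log_radius_add_posLog hs.ne',
    circleAverage_log_norm_sub_const_eq_log_radius_add_posLog hs.ne']
  simp
  ring

theorem ellipseAverage_of_le {τ s : ℝ} (hs : 0 < s) {z g h : ℂ} (hadd : g + h = z)
    (hmul : g * h = τ * s ^ 2) (hg : s ≤ ‖g‖) (hh : ‖h‖ ≤ s) :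
    ellipseAverage τ s z = Real.log ‖g‖ := by
  rw [ellipseAverage_eq hs hadd hmul, Real.posLog_eq_log, (Real.posLog_eq_zero_iff _).2,
    Real.log_mul (inv_ne_zero hs.ne') (hs.trans_le hg).ne', Real.log_inv]
  · ring
  · rw [abs_of_nonneg (by positivity), inv_mul_le_iff₀ hs]; linarith
  · rw [abs_of_nonneg (by positivity), le_inv_mul_iff₀ hs]; linarith

theorem ellipseAverage_of_ge {τ s : ℝ} (hs : 0 < s) {z g h : ℂ} (hadd : g + h = z)
    (hmul : g * h = τ * s ^ 2) (hg : ‖g‖ ≤ s) (hh : ‖h‖ ≤ s) :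
    ellipseAverage τ s z = Real.log s := by
  rw [ellipseAverage_eq hs hadd hmul, (Real.posLog_eq_zero_iff _).2, (Real.posLog_eq_zero_iff _).2]
  · ring
  · rw [abs_of_nonneg (by positivity), inv_mul_le_iff₀ hs]; linarith
  · rw [abs_of_nonneg (by positivity), inv_mul_le_iff₀ hs]; linarith

theorem re_im_of_add_eq_mul_eq {τ s : ℝ} {z g h : ℂ} (hadd : g + h = z)
    (hmul : g * h = τ * s ^ 2) (hg : g ≠ 0) :
    z.re = (1 + τ * (s ^ 2 / Complex.normSq g)) * g.re ∧
    z.im = (1 - τ * (s ^ 2 / Complex.normSq g)) * g.im := by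
  have hh : h = ((τ * (s ^ 2 / Complex.normSq g) : ℝ) : ℂ) * conj g := by
    have : (Complex.normSq g : ℂ) ≠ 0 := by exact_mod_cast (Complex.normSq_pos.2 hg).ne'
    rw [eq_comm]
    apply mul_left_cancel₀ hg
    push_cast
    rw [hmul, mul_left_comm, Complex.mul_conj]
    field_simp
  rw [← hadd, hh]
  constructor
  · rw [Complex.add_re, Complex.re_ofReal_mul, Complex.conj_re]; ring
  · rw [Complex.add_im, Complex.im_ofReal_mul, Complex.conj_im]; ring

/-- The position of `z = g + τ s² / g` relative to the ellipse of parameter `s` is decided by the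
size of the larger root `g`. The three lemmas after the next one read this off the signs of the
factors. -/
theorem ellipseGauge_sub_sq_eq {τ s : ℝ} (h0 : 0 ≤ τ) (h1 : τ < 1) {z g h : ℂ} (hadd : g + h = z)
    (hmul : g * h = τ * s ^ 2) (hg : g ≠ 0) :
    ellipseGauge τ z - s ^ 2 = (1 - s ^ 2 / ‖g‖ ^ 2) * (1 - τ ^ 2 * (s ^ 2 / ‖g‖ ^ 2)) *
      ((g.re / (1 + τ)) ^ 2 + (g.im / (1 - τ)) ^ 2) := by
  obtain ⟨hre, him⟩ := re_im_of_add_eq_mul_eq hadd hmul hg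
  have hn : 0 < Complex.normSq g := Complex.normSq_pos.2 hg
  have e1 : s ^ 2 = s ^ 2 / Complex.normSq g * (g.re ^ 2 + g.im ^ 2) := by
    have : g.re ^ 2 + g.im ^ 2 = Complex.normSq g := by rw [Complex.normSq_apply]; ring
    rw [this]; field_simp
  rw [← Complex.normSq_eq_norm_sq]
  unfold ellipseGauge
  rw [hre, him]
  set q := s ^ 2 / Complex.normSq g
  rw [e1]
  have : 1 + τ ≠ 0 := by linarith
  have : 1 - τ ≠ 0 := by linarith
  field_simp
  ring

theorem ellipseGauge_pos {τ : ℝ} (h0 : 0 ≤ τ) (h1 : τ < 1) {z : ℂ} (hz : z ≠ 0) :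
    0 < ellipseGauge τ z := by
  unfold ellipseGauge
  have a : 0 < 1 + τ := by linarith
  have b : 0 < 1 - τ := by linarith
  by_cases h : z.re = 0
  · have : z.im ≠ 0 := fun h' => hz (Complex.ext h h')
    positivity
  · positivity

theorem sq_le_ellipseGauge {τ s : ℝ} (h0 : 0 ≤ τ) (h1 : τ < 1) (hs : 0 < s) {z g h : ℂ}
    (hadd : g + h = z) (hmul : g * h = τ * s ^ 2) (hg : s ≤ ‖g‖) : s ^ 2 ≤ ellipseGauge τ z := by
  have hg0 : g ≠ 0 := norm_pos_iff.1 (hs.trans_le hg)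
  have hq : s ^ 2 / ‖g‖ ^ 2 ≤ 1 := by
    rw [div_le_one (by positivity)]; gcongr
  have hq0 : 0 ≤ s ^ 2 / ‖g‖ ^ 2 := by positivity
  have := ellipseGauge_sub_sq_eq h0 h1 hadd hmul hg0
  have h3 : 0 ≤ 1 - τ ^ 2 * (s ^ 2 / ‖g‖ ^ 2) := by nlinarith
  have := mul_nonneg (mul_nonneg (sub_nonneg.2 hq) h3) (ellipseGauge_pos h0 h1 hg0).le
  unfold ellipseGauge at *
  linarith

theorem sq_lt_ellipseGauge {τ s : ℝ} (h0 : 0 ≤ τ) (h1 : τ < 1) (hs : 0 < s) {z g h : ℂ}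
    (hadd : g + h = z) (hmul : g * h = τ * s ^ 2) (hg : s < ‖g‖) : s ^ 2 < ellipseGauge τ z := by
  have hg0 : g ≠ 0 := norm_pos_iff.1 (hs.trans hg)
  have hq : s ^ 2 / ‖g‖ ^ 2 < 1 := by
    rw [div_lt_one (by positivity)]; gcongr
  have hq0 : 0 ≤ s ^ 2 / ‖g‖ ^ 2 := by positivity
  have := ellipseGauge_sub_sq_eq h0 h1 hadd hmul hg0
  have h3 : 0 < 1 - τ ^ 2 * (s ^ 2 / ‖g‖ ^ 2) := by nlinarith
  have := mul_pos (mul_pos (sub_pos.2 hq) h3) (ellipseGauge_pos h0 h1 hg0)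
  unfold ellipseGauge at *
  linarith

theorem ellipseGauge_le_sq {τ s : ℝ} (h0 : 0 ≤ τ) (h1 : τ < 1) (hs : 0 < s) {z g h : ℂ}
    (hadd : g + h = z) (hmul : g * h = τ * s ^ 2) (hhg : ‖h‖ ≤ ‖g‖) (hg : ‖g‖ ≤ s) :
    ellipseGauge τ z ≤ s ^ 2 := by
  by_cases hg0 : g = 0
  · have hh0 : h = 0 := by rw [hg0, norm_zero] at hhg; exact norm_le_zero_iff.1 hhg
    rw [← hadd, hg0, hh0]
    simp [ellipseGauge]
    positivity
  have hgp : 0 < ‖g‖ := norm_pos_iff.2 hg0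
  have hprod : ‖g‖ * ‖h‖ = τ * s ^ 2 := by
    rw [← norm_mul, hmul]
    simp [abs_of_nonneg h0]
  have hq : 1 ≤ s ^ 2 / ‖g‖ ^ 2 := by
    rw [one_le_div (by positivity)]; gcongr
  have h4 : τ * s ^ 2 ≤ ‖g‖ ^ 2 := by rw [← hprod]; nlinarith
  have h5 : τ ^ 2 * (s ^ 2 / ‖g‖ ^ 2) ≤ 1 := by
    rw [← mul_div_assoc, div_le_one (by positivity)]
    nlinarith [sq_nonneg s, mul_nonneg h0 (sq_nonneg s)]
  have := ellipseGauge_sub_sq_eq h0 h1 hadd hmul hg0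
  have := mul_nonneg (mul_nonneg (sub_nonneg.2 hq) (sub_nonneg.2 h5))
    (ellipseGauge_pos h0 h1 hg0).le
  unfold ellipseGauge at *
  linarith

theorem ellipseGauge_ellipseMap {τ : ℝ} (h0 : 0 ≤ τ) (h1 : τ < 1) (ζ : ℂ) :
    ellipseGauge τ (ellipseMap τ ζ) = ‖ζ‖ ^ 2 := by
  have : 1 + τ ≠ 0 := by linarith
  have : 1 - τ ≠ 0 := by linarith
  rw [← Complex.normSq_eq_norm_sq, Complex.normSq_apply]
  unfold ellipseGauge ellipseMap
  rw [Complex.add_re, Complex.add_im, Complex.re_ofReal_mul, Complex.im_ofReal_mul,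
    Complex.conj_re, Complex.conj_im]
  field_simp
  ring

/-- The mean of `log |z - ·|` over an ellipse is constant for `z` inside it. -/
theorem ellipseAverage_of_ellipseGauge_le {τ s : ℝ} (h0 : 0 ≤ τ) (h1 : τ < 1) (hs : 0 < s) {z : ℂ}
    (hz : ellipseGauge τ z ≤ s ^ 2) : ellipseAverage τ s z = Real.log s := by
  obtain ⟨g, h, hadd, hmul, hle⟩ := exists_add_eq_mul_eq z (τ * s ^ 2)
  have hg : ‖g‖ ≤ s := by
    by_contra! hlt
    exact (sq_lt_ellipseGauge h0 h1 hs hadd hmul hlt).not_ge hz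
  exact ellipseAverage_of_ge hs hadd hmul hg (hle.trans hg)

theorem hasDerivAt_log_norm {g : ℝ → ℂ} {g' : ℂ} {s : ℝ} (hg : HasDerivAt g g' s)
    (h0 : g s ≠ 0) : HasDerivAt (fun s => Real.log ‖g s‖) (g' / g s).re s := by
  have h1 := (hg.norm_sq.log (pow_ne_zero 2 (norm_ne_zero_iff.2 h0))).const_mul (1 / 2)
  have e1 : (fun s => Real.log ‖g s‖) = fun s => 1 / 2 * Real.log (‖g s‖ ^ 2) := by
    ext t
    rw [Real.log_pow]; push_cast; ring
  have e2 : (g' / g s).re = 1 / 2 * (2 * inner ℝ (g s) g' / ‖g s‖ ^ 2) := by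
    rw [Complex.inner, ← Complex.normSq_eq_norm_sq, Complex.div_re, Complex.mul_re, Complex.conj_re,
      Complex.conj_im]
    ring
  rw [e1, e2]
  exact h1

/-- The derivative assumed for `g` is the one that differentiating `g² - z g + τ s² = 0` yields,
with `h = z - g` the other root. -/
theorem hasDerivAt_primitive {τ s : ℝ} {g : ℝ → ℂ} {h : ℂ} (hmul : g s * h = τ * (s : ℂ) ^ 2)
    (hgs : g s ≠ 0) (hgh : g s - h ≠ 0) (hg : HasDerivAt g (-(2 * τ * s) / (g s - h)) s) :
    HasDerivAt (fun s : ℝ => s ^ 2 * Real.log ‖g s‖ + τ * s ^ 4 / 2 * ((g s ^ 2)⁻¹).re)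
      (2 * s * Real.log ‖g s‖) s := by
  set G : ℂ := -(2 * τ * s) / (g s - h) with hG
  have d1 := (hasDerivAt_pow 2 s).fun_mul (hasDerivAt_log_norm hg hgs)
  have d3 := (hg.fun_pow 2).fun_inv (pow_ne_zero 2 hgs)
  have d2 : HasDerivAt (fun s => ((g s ^ 2)⁻¹).re) _ s :=
    (Complex.reCLM.hasFDerivAt (x := (g s ^ 2)⁻¹)).comp_hasDerivAt s d3
  have d4 := ((hasDerivAt_pow 4 s).const_mul τ).div_const 2
  refine (d1.fun_add (d4.fun_mul d2)).congr_deriv ?_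
  have key : ((s ^ 2 : ℝ) : ℂ) * (G / g s) + ((2 * τ * s ^ 3 : ℝ) : ℂ) * (g s ^ 2)⁻¹
      + ((τ * s ^ 4 / 2 : ℝ) : ℂ) * (-(2 * g s * G) / (g s ^ 2) ^ 2) = 0 := by
    have hGe : G * (g s - h) = -(2 * τ * s) := div_mul_cancel₀ _ hgh
    push_cast
    field_simp
    linear_combination (s : ℂ) ^ 2 * g s * hGe + G * (s : ℂ) ^ 2 * hmul
  have key2 := congrArg Complex.re key
  rw [Complex.add_re, Complex.add_re, Complex.re_ofReal_mul, Complex.re_ofReal_mul,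
    Complex.re_ofReal_mul, Complex.zero_re] at key2
  simp only [Complex.reCLM_apply, Nat.cast_ofNat, Nat.add_one_sub_one, pow_one] at *
  linarith

/-- With `z` outside the ellipse of parameter `σ`, written `z = g₀ + τ σ² / g₀` with
`σ ≤ |g₀|`, the averages over the smaller homothetic ellipses are `log |g s|` for the branch `g s`
of `g + τ s² / g = z` with `g σ = g₀`, and `2 s log |g s|` has an explicit primitive. -/
theorem integral_ellipseAverage {τ σ : ℝ} (h0 : 0 ≤ τ) (h1 : τ < 1) (hσ : 0 < σ) {z g₀ h₀ : ℂ}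
    (hadd₀ : g₀ + h₀ = z) (hmul₀ : g₀ * h₀ = τ * σ ^ 2) (hg₀ : σ ≤ ‖g₀‖) :
    IntervalIntegrable (fun s => 2 * s * ellipseAverage τ s z) volume 0 σ ∧
    ∫ s in (0 : ℝ)..σ, 2 * s * ellipseAverage τ s z
      = σ ^ 2 * Real.log ‖g₀‖ + τ * σ ^ 4 / 2 * ((g₀ ^ 2)⁻¹).re := by
  -- `z` lies outside every ellipse with parameter `s < σ`, which forces `s ≤ |g s|` below
  have hge : σ ^ 2 ≤ ellipseGauge τ z := sq_le_ellipseGauge h0 h1 hσ hadd₀ hmul₀ hg₀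
  have hz : z ≠ 0 := by
    rintro rfl
    simp [ellipseGauge] at hge
    exact hσ.ne' hge
  have hz2 : z ^ 2 ≠ 0 := pow_ne_zero 2 hz
  set a : ℝ → ℂ := fun s => 1 - 4 * τ * (s : ℂ) ^ 2 / z ^ 2 with ha
  -- the branch points of the square root are the foci, which lie inside the ellipse
  have hslit : ∀ s ∈ Set.Icc 0 σ, a s ∈ Complex.slitPlane := by
    intro s hs
    by_contra hns
    rw [Complex.mem_slitPlane_iff, not_or, not_lt, not_not] at hns
    obtain ⟨hre, him⟩ := hns
    have hρ : (((1 - (a s).re : ℝ) : ℂ)) * z ^ 2 = ((4 * τ * s ^ 2 : ℝ) : ℂ) := by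
      have : (((a s).re : ℝ) : ℂ) = a s := Complex.ext (by simp) (by simp [him])
      rw [Complex.ofReal_sub, this]
      simp only [ha]
      push_cast
      field_simp
      ring
    have hρ1 : 1 ≤ 1 - (a s).re := by linarith
    set ρ := 1 - (a s).re
    have e1 := congrArg Complex.re hρ
    have e2 := congrArg Complex.im hρ
    rw [Complex.re_ofReal_mul, Complex.ofReal_re, sq z, Complex.mul_re] at e1
    rw [Complex.im_ofReal_mul, Complex.ofReal_im, sq z, Complex.mul_im] at e2
    have hxy : z.re * z.im = 0 := by
      have : ρ * (2 * (z.re * z.im)) = 0 := by linarith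
      rcases mul_eq_zero.1 this with h | h <;> linarith
    have hs2 : 0 ≤ 4 * τ * s ^ 2 := by positivity
    have him0 : z.im = 0 := by
      rcases mul_eq_zero.1 hxy with h | h
      · rw [h] at e1
        have : z.im * z.im ≤ 0 := by nlinarith [mul_self_nonneg z.im]
        nlinarith [mul_self_nonneg z.im]
      · exact h
    rw [him0] at e1
    have hx : z.re ^ 2 ≤ 4 * τ * s ^ 2 := by nlinarith [sq_nonneg z.re]
    have hsσ : s ^ 2 ≤ σ ^ 2 := by have := hs.1; have := hs.2; gcongr
    have hτp : 0 < (1 + τ) ^ 2 := by positivity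
    unfold ellipseGauge at hge
    rw [him0, zero_div, div_pow, zero_pow two_ne_zero, add_zero, le_div_iff₀ hτp] at hge
    have : 0 < (1 - τ) ^ 2 * σ ^ 2 := by
      have : 0 < 1 - τ := by linarith
      positivity
    nlinarith [mul_le_mul_of_nonneg_left hsσ h0]
  set r : ℝ → ℂ := fun s => (a s) ^ (2⁻¹ : ℂ) with hr
  have hr2 : ∀ s, r s ^ 2 = a s := fun s => by
    have := Complex.cpow_nat_inv_pow (a s) two_ne_zero
    rwa [Nat.cast_ofNat] at this
  have hrre : ∀ s ∈ Set.Icc 0 σ, 0 < (r s).re := by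
    intro s hs
    simp only [hr]
    rw [Complex.cpow_inv_two_re]
    refine Real.sqrt_pos.2 (half_pos ?_)
    rcases Complex.mem_slitPlane_iff.1 (hslit s hs) with h | h
    · have := norm_nonneg (a s)
      linarith
    · have := (abs_lt.1 (Complex.abs_re_lt_norm.2 h)).1
      linarith
  set g : ℝ → ℂ := fun s => z * (1 + r s) / 2 with hg
  set h : ℝ → ℂ := fun s => z * (1 - r s) / 2 with hh
  have hadd : ∀ s, g s + h s = z := fun s => by simp only [hg, hh]; ring
  have hmul : ∀ s, g s * h s = τ * (s : ℂ) ^ 2 := fun s => by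
    have : g s * h s = z ^ 2 * (1 - r s ^ 2) / 4 := by simp only [hg, hh]; ring
    rw [this, hr2]
    simp only [ha]
    field_simp
    ring
  have hlt : ∀ s ∈ Set.Icc 0 σ, ‖h s‖ < ‖g s‖ := by
    intro s hs
    have hlt : ‖1 - r s‖ < ‖1 + r s‖ := by
      rw [← sq_lt_sq₀ (norm_nonneg _) (norm_nonneg _), ← Complex.normSq_eq_norm_sq,
        ← Complex.normSq_eq_norm_sq, Complex.normSq_apply, Complex.normSq_apply]
      simp only [Complex.sub_re, Complex.add_re, Complex.sub_im, Complex.add_im, Complex.one_re,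
        Complex.one_im]
      nlinarith [hrre s hs]
    simp only [hg, hh, norm_div, norm_mul]
    have hzp := norm_pos_iff.2 hz
    exact div_lt_div_of_pos_right (mul_lt_mul_of_pos_left hlt hzp) (by simp)
  have hgσ : g σ = g₀ := by
    have hprod : (g₀ - g σ) * (g₀ - h σ) = 0 := by
      linear_combination hmul σ - hmul₀ - g₀ * hadd σ + g₀ * hadd₀
    rcases mul_eq_zero.1 hprod with h' | h'
    · exact (sub_eq_zero.1 h').symm
    · exfalso
      have e1 : h σ = g₀ := (sub_eq_zero.1 h').symm
      have e2 : g σ = h₀ := by linear_combination hadd σ - hadd₀ - e1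
      have hl := hlt σ ⟨hσ.le, le_rfl⟩
      rw [e1, e2] at hl
      have hn : ‖g₀‖ * ‖h₀‖ = τ * σ ^ 2 := by
        rw [← norm_mul, hmul₀]
        simp [abs_of_nonneg h0]
      nlinarith [norm_nonneg g₀, norm_nonneg h₀, sq_nonneg σ]
  have hsg : ∀ s ∈ Set.Icc 0 σ, s ≤ ‖g s‖ := by
    intro s hs
    by_contra! hl
    have hs0 : 0 < s := (norm_nonneg _).trans_lt hl
    have h2 := hge.trans (ellipseGauge_le_sq h0 h1 hs0 (hadd s) (hmul s) (hlt s hs).le hl.le)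
    have h3 : s = σ := le_antisymm hs.2 ((sq_le_sq₀ hσ.le hs0.le).1 h2)
    rw [h3, hgσ] at hl
    linarith
  have hg0 : ∀ s ∈ Set.Icc 0 σ, g s ≠ 0 := fun s hs =>
    norm_pos_iff.1 ((norm_nonneg _).trans_lt (hlt s hs))
  have hW : ∀ s ∈ Set.Ioc 0 σ, 2 * s * ellipseAverage τ s z = 2 * s * Real.log ‖g s‖ := by
    intro s hs
    have hs' : s ∈ Set.Icc 0 σ := ⟨hs.1.le, hs.2⟩
    have hn : ‖g s‖ * ‖h s‖ = τ * s ^ 2 := by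
      rw [← norm_mul, hmul]
      simp [abs_of_nonneg h0]
    have hhs : ‖h s‖ ≤ s := by
      by_contra! hl
      nlinarith [hsg s hs', hs.1]
    rw [ellipseAverage_of_le hs.1 (hadd s) (hmul s) (hsg s hs') hhs]
  have hgd : ∀ s ∈ Set.Icc 0 σ, HasDerivAt g (-(2 * τ * s) / (g s - h s)) s := by
    intro s hs
    have hr0 : r s ≠ 0 := fun h => by have := hrre s hs; rw [h] at this; simp at this
    have had : HasDerivAt a (-(8 * τ * s / z ^ 2)) s := by
      have h1 : HasDerivAt (fun s : ℝ => (s : ℂ)) 1 s := Complex.ofRealCLM.hasDerivAt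
      have h2 := (((h1.pow 2).const_mul (4 * τ : ℂ)).div_const (z ^ 2)).const_sub 1
      refine h2.congr_deriv ?_
      push_cast
      ring
    obtain ⟨d, hd⟩ : ∃ d, HasDerivAt r d s :=
      ⟨_, (Complex.hasStrictDerivAt_cpow_const (c := 2⁻¹) (hslit s hs)).hasDerivAt.comp s had⟩
    have hd2 : 2 * r s * d = -(8 * τ * s / z ^ 2) := by
      have h1 := hd.pow 2
      have h2 : r ^ 2 = a := funext hr2
      rw [h2] at h1
      rw [← h1.unique had]
      push_cast
      ring
    have hgd := ((hd.const_add 1).const_mul z).div_const 2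
    refine hgd.congr_deriv ?_
    have e : g s - h s = z * r s := by simp only [hg, hh]; ring
    rw [e, eq_div_iff (mul_ne_zero hz hr0)]
    have : z * d / 2 * (z * r s) = z ^ 2 / 4 * (2 * r s * d) := by ring
    rw [this, hd2]
    field_simp
    ring
  have hF : ∀ s ∈ Set.Icc 0 σ, HasDerivAt (fun s : ℝ => s ^ 2 * Real.log ‖g s‖
      + τ * s ^ 4 / 2 * ((g s ^ 2)⁻¹).re) (2 * s * Real.log ‖g s‖) s := by
    intro s hs
    refine hasDerivAt_primitive (hmul s) (hg0 s hs) (fun h' => ?_) (hgd s hs)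
    have := hlt s hs
    rw [sub_eq_zero.1 h'] at this
    exact lt_irrefl _ this
  have hint : IntervalIntegrable (fun s => 2 * s * Real.log ‖g s‖) volume 0 σ := by
    refine ContinuousOn.intervalIntegrable ?_
    rw [Set.uIcc_of_le hσ.le]
    have hgc : ContinuousOn g (Set.Icc 0 σ) := fun s hs =>
      (hgd s hs).continuousAt.continuousWithinAt
    exact (by fun_prop : ContinuousOn (fun s : ℝ => 2 * s) _).mul
      (hgc.norm.log fun s hs => (norm_pos_iff.2 (hg0 s hs)).ne')
  have hIoc : Set.uIoc 0 σ = Set.Ioc 0 σ := Set.uIoc_of_le hσ.le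
  constructor
  · refine hint.congr fun s hs => ?_
    rw [hIoc] at hs
    exact (hW s hs).symm
  · rw [intervalIntegral.integral_congr_ae (g := fun s => 2 * s * Real.log ‖g s‖)
      (Eventually.of_forall fun s hs => hW s (hIoc ▸ hs)),
      intervalIntegral.integral_eq_sub_of_hasDerivAt (fun s hs => hF s (by
        rwa [Set.uIcc_of_le hσ.le] at hs)) hint, hgσ]
    simp

/-! ### Comparison with the quadratic part of the potential -/

/-- The quadratic part `(|z|² - τ Re z²) / (1 - τ²)` of the potential. -/
def ellipticPotential (τ : ℝ) (z : ℂ) : ℝ := 1 / (1 - τ ^ 2) * (‖z‖ ^ 2 - τ * (z ^ 2).re)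

theorem ellipticPotential_eq {τ : ℝ} (h0 : 0 ≤ τ) (h1 : τ < 1) (z : ℂ) :
    ellipticPotential τ z = z.re ^ 2 / (1 + τ) + z.im ^ 2 / (1 - τ) := by
  have a : 1 + τ ≠ 0 := by linarith
  have b : 1 - τ ≠ 0 := by linarith
  have : 1 - τ ^ 2 = (1 + τ) * (1 - τ) := by ring
  rw [ellipticPotential, this, ← Complex.normSq_eq_norm_sq, Complex.normSq_apply, sq z,
    Complex.mul_re]
  field_simp
  ring

theorem ellipticPotential_ellipseMap {τ : ℝ} (h0 : 0 ≤ τ) (h1 : τ < 1) (ζ : ℂ) :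
    ellipticPotential τ (ellipseMap τ ζ) = ‖ζ‖ ^ 2 + τ * (ζ ^ 2).re := by
  have : 1 + τ ≠ 0 := by linarith
  have : 1 - τ ≠ 0 := by linarith
  rw [ellipticPotential_eq h0 h1, ← Complex.normSq_eq_norm_sq, Complex.normSq_apply, sq ζ,
    Complex.mul_re]
  unfold ellipseMap
  rw [Complex.add_re, Complex.add_im, Complex.re_ofReal_mul, Complex.im_ofReal_mul,
    Complex.conj_re, Complex.conj_im]
  field_simp
  ring

theorem exists_ellipseMap_eq {τ : ℝ} (h0 : 0 ≤ τ) (h1 : τ < 1) (z : ℂ) :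
    ∃ ζ, ellipseMap τ ζ = z := by
  have : 1 + τ ≠ 0 := by linarith
  have : 1 - τ ≠ 0 := by linarith
  refine ⟨⟨z.re / (1 + τ), z.im / (1 - τ)⟩, Complex.ext ?_ ?_⟩
  · unfold ellipseMap
    rw [Complex.add_re, Complex.re_ofReal_mul, Complex.conj_re]
    field_simp
  · unfold ellipseMap
    rw [Complex.add_im, Complex.im_ofReal_mul, Complex.conj_im]
    field_simp
    ring

theorem integral_two_mul_mul_log {σ : ℝ} (h0 : 0 ≤ σ) (h1 : σ ≤ 1) :
    ∫ s in σ..1, 2 * s * Real.log s = -1 / 2 - σ ^ 2 * Real.log σ + σ ^ 2 / 2 := by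
  have hc : Continuous fun s : ℝ => s * Real.log s := Real.continuous_mul_log
  rw [intervalIntegral.integral_eq_sub_of_hasDerivAt_of_le (f := fun s => s * (s * Real.log s)
    - s ^ 2 / 2) h1 (by fun_prop)]
  · simp
    ring
  · intro s hs
    have hs0 : s ≠ 0 := (h0.trans_lt hs.1).ne'
    refine (((hasDerivAt_id s).fun_mul
      ((hasDerivAt_id s).fun_mul (Real.hasDerivAt_log hs0))).fun_sub
        ((hasDerivAt_pow 2 s).div_const 2)).congr_deriv ?_
    simp only [id]
    field_simp
    push_cast
    ring
  · have : Continuous fun s : ℝ => 2 * s * Real.log s := by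
      simp only [mul_assoc]; fun_prop
    exact this.intervalIntegrable _ _

/-- Inside the ellipse the logarithmic potential is a quadratic polynomial. -/
theorem integral_ellipseAverage_of_le {τ : ℝ} (h0 : 0 ≤ τ) (h1 : τ < 1) {z : ℂ}
    (hz : ellipseGauge τ z ≤ 1) :
    ∫ s in (0 : ℝ)..1, 2 * s * ellipseAverage τ s z = (ellipticPotential τ z - 1) / 2 := by
  obtain ⟨ζ, rfl⟩ := exists_ellipseMap_eq h0 h1 z
  rw [ellipticPotential_ellipseMap h0 h1]
  have hG := ellipseGauge_ellipseMap h0 h1 ζ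
  rw [hG] at hz
  have hσ1 : ‖ζ‖ ≤ 1 := by nlinarith [norm_nonneg ζ]
  have hcong : Set.EqOn (fun s => 2 * s * Real.log s)
      (fun s => 2 * s * ellipseAverage τ s (ellipseMap τ ζ)) (Set.uIoc ‖ζ‖ 1) := by
    intro s hs
    rw [Set.uIoc_of_le hσ1] at hs
    have hs0 : 0 < s := (norm_nonneg ζ).trans_lt hs.1
    simp only
    rw [ellipseAverage_of_ellipseGauge_le h0 h1 hs0]
    rw [hG]
    exact pow_le_pow_left₀ (norm_nonneg _) hs.1.le 2
  have hout : ∫ s in ‖ζ‖..1, 2 * s * ellipseAverage τ s (ellipseMap τ ζ)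
      = -1 / 2 - ‖ζ‖ ^ 2 * Real.log ‖ζ‖ + ‖ζ‖ ^ 2 / 2 := by
    rw [← integral_two_mul_mul_log (norm_nonneg _) hσ1]
    exact intervalIntegral.integral_congr_ae (Eventually.of_forall fun s hs => (hcong hs).symm)
  -- at the centre the part `[0, ‖ζ‖]` of the integral is empty and the primitive does not apply
  by_cases hζ : ζ = 0
  · subst hζ
    simpa using hout
  have hσ0 : 0 < ‖ζ‖ := norm_pos_iff.2 hζ
  have hmul : ζ * (τ * conj ζ) = τ * (‖ζ‖ : ℂ) ^ 2 := by
    rw [mul_left_comm, Complex.mul_conj']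
  obtain ⟨hi, he⟩ := integral_ellipseAverage h0 h1 hσ0 (z := ellipseMap τ ζ) (g₀ := ζ)
    (h₀ := τ * conj ζ) rfl hmul le_rfl
  have hcont : IntervalIntegrable (fun s => 2 * s * Real.log s) volume ‖ζ‖ 1 := by
    have : Continuous fun s : ℝ => 2 * s * Real.log s := by
      have hc : Continuous fun s : ℝ => s * Real.log s := Real.continuous_mul_log
      simp only [mul_assoc]; fun_prop
    exact this.intervalIntegrable _ _
  rw [← intervalIntegral.integral_add_adjacent_intervals hi (hcont.congr hcong), he, hout]
  have hre : ((ζ ^ 2)⁻¹).re = (ζ ^ 2).re / ‖ζ‖ ^ 4 := by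
    rw [Complex.inv_re, Complex.normSq_eq_norm_sq, norm_pow]
    ring
  rw [hre]
  field_simp
  ring

theorem log_le_sub_inv_div_two {n : ℝ} (hn : 1 ≤ n) : Real.log n ≤ (n - n⁻¹) / 2 := by
  rw [← Real.sinh_log (by linarith)]
  exact Real.self_le_sinh_iff.2 (Real.log_nonneg hn)

/-- Outside the ellipse, with `z = g + τ / g` and `|g| ≥ 1`, the potential of the ellipse stays
below the quadratic polynomial that describes it inside. -/
theorem log_add_re_inv_sq_le {τ : ℝ} (h0 : 0 ≤ τ) (h1 : τ < 1) {z g h : ℂ} (hadd : g + h = z)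
    (hmul : g * h = τ) (hg : 1 ≤ ‖g‖) :
    Real.log ‖g‖ + τ / 2 * ((g ^ 2)⁻¹).re ≤ (ellipticPotential τ z - 1) / 2 := by
  have hg0 : g ≠ 0 := norm_pos_iff.1 (one_pos.trans_le hg)
  obtain ⟨hre, him⟩ := re_im_of_add_eq_mul_eq (τ := τ) (s := 1) hadd (by simpa using hmul) hg0
  rw [ellipticPotential_eq h0 h1, hre, him]
  have hn1 : 1 ≤ Complex.normSq g := by rw [Complex.normSq_eq_norm_sq]; nlinarith
  have hlog : Real.log ‖g‖ = Real.log (Complex.normSq g) / 2 := by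
    rw [Complex.normSq_eq_norm_sq, Real.log_pow]; push_cast; ring
  have hinv : ((g ^ 2)⁻¹).re = (g.re ^ 2 - g.im ^ 2) / Complex.normSq g ^ 2 := by
    rw [Complex.inv_re, map_pow, sq g, Complex.mul_re]; ring
  have hl := log_le_sub_inv_div_two hn1
  have hsum : g.re ^ 2 = Complex.normSq g - g.im ^ 2 := by rw [Complex.normSq_apply]; ring
  rw [hlog, hinv]
  set n := Complex.normSq g with hn
  have hn0 : 0 < n := by linarith
  have a : 0 < 1 + τ := by linarith
  have b : 0 < 1 - τ := by linarith
  have hY := sq_nonneg g.im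
  -- the difference is affine in `(Im g)²` for fixed `|g|²`, with nonnegative coefficients
  have key : ((1 + τ * (1 ^ 2 / n)) * g.re) ^ 2 / (1 + τ)
      + ((1 - τ * (1 ^ 2 / n)) * g.im) ^ 2 / (1 - τ) - 1 - τ * ((g.re ^ 2 - g.im ^ 2) / n ^ 2)
      = (n - n⁻¹) / 2 + (n - 1) ^ 2 * (1 - τ) / (2 * n * (1 + τ))
        + 2 * τ * (n - 1) ^ 2 / (n ^ 2 * ((1 + τ) * (1 - τ))) * g.im ^ 2 := by
    rw [mul_pow, mul_pow, hsum]
    field_simp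
    ring
  have p1 : 0 ≤ (n - 1) ^ 2 * (1 - τ) / (2 * n * (1 + τ)) := by positivity
  have p2 : 0 ≤ 2 * τ * (n - 1) ^ 2 / (n ^ 2 * ((1 + τ) * (1 - τ))) * g.im ^ 2 := by positivity
  linarith

theorem integral_ellipseAverage_le {τ : ℝ} (h0 : 0 ≤ τ) (h1 : τ < 1) (z : ℂ) :
    ∫ s in (0 : ℝ)..1, 2 * s * ellipseAverage τ s z ≤ (ellipticPotential τ z - 1) / 2 := by
  rcases le_or_gt (ellipseGauge τ z) 1 with hz | hz
  · exact (integral_ellipseAverage_of_le h0 h1 hz).le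
  obtain ⟨g, h, hadd, hmul, hle⟩ := exists_add_eq_mul_eq z τ
  have hmul' : g * h = τ * ((1 : ℝ) : ℂ) ^ 2 := by simpa using hmul
  have hg : 1 ≤ ‖g‖ := by
    by_contra! hlt
    have := ellipseGauge_le_sq h0 h1 one_pos hadd hmul' hle hlt.le
    linarith
  rw [(integral_ellipseAverage h0 h1 one_pos hadd hmul' hg).2]
  have := log_add_re_inv_sq_le h0 h1 hadd hmul hg
  simpa using this

theorem integral_ellipseAverage_zero {z : ℂ} (hz : 1 ≤ ‖z‖) :
    ∫ s in (0 : ℝ)..1, 2 * s * ellipseAverage 0 s z = Real.log ‖z‖ := by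
  rw [(integral_ellipseAverage le_rfl one_pos one_pos (z := z) (g₀ := z) (h₀ := 0) (by simp)
    (by simp) hz).2]
  simp

/-! ### The logarithmic potential of an ellipse -/

theorem preimage_sub_left_ball (z : ℂ) (R : ℝ) :
    (fun t => z - t) ⁻¹' Metric.ball 0 R = Metric.ball z R := by
  ext w
  rw [Set.mem_preimage, mem_ball_zero_iff, mem_ball_iff_norm']

theorem integrableOn_log_norm_sub (z : ℂ) {K : Set ℂ} (hK : Bornology.IsBounded K) :
    IntegrableOn (fun w : ℂ => Real.log ‖z - w‖) K := by
  obtain ⟨R, hR⟩ := hK.subset_ball z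
  refine IntegrableOn.mono_set ?_ hR
  have h := ((Measure.measurePreserving_sub_left (volume : Measure ℂ) z).integrableOn_comp_preimage
    (Homeomorph.subLeft z).measurableEmbedding).2 (integrableOn_log_norm_ball R)
  rwa [preimage_sub_left_ball] at h

/-- `ellipseMap τ` as a continuous linear map. -/
def ellipseCLM (τ : ℝ) : ℂ →L[ℝ] ℂ :=
  ContinuousLinearMap.id ℝ ℂ + τ • (Complex.conjCLE : ℂ →L[ℝ] ℂ)

theorem ellipseCLM_apply (τ : ℝ) (w : ℂ) : ellipseCLM τ w = ellipseMap τ w := by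
  simp [ellipseCLM, ellipseMap]

theorem det_ellipseCLM (τ : ℝ) : (ellipseCLM τ).det = 1 - τ ^ 2 := by
  rw [ContinuousLinearMap.det, ← LinearMap.det_toMatrix Complex.basisOneI, Matrix.det_fin_two]
  simp [LinearMap.toMatrix_apply, ellipseCLM]
  ring

theorem ellipseMap_injective {τ : ℝ} (h0 : 0 ≤ τ) (h1 : τ < 1) :
    Function.Injective (ellipseMap τ) := by
  intro a b hab
  have h := ellipseGauge_ellipseMap h0 h1 (a - b)
  have : ellipseMap τ (a - b) = 0 := by
    have : ellipseMap τ (a - b) = ellipseMap τ a - ellipseMap τ b := by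
      simp only [ellipseMap, map_sub]; ring
    rw [this, hab, sub_self]
  rw [this] at h
  simp [ellipseGauge] at h
  exact sub_eq_zero.1 (norm_eq_zero.1 (eq_zero_of_pow_eq_zero h.symm))

theorem ellipseGauge_smul (τ k : ℝ) (z : ℂ) :
    ellipseGauge τ (k * z) = k ^ 2 * ellipseGauge τ z := by
  simp only [ellipseGauge, Complex.re_ofReal_mul, Complex.im_ofReal_mul]
  ring

/-- The closed ellipse with centre `p` and semi-axes `k (1 + τ)` and `k (1 - τ)`. -/
def ellipse (τ k : ℝ) (p : ℂ) : Set ℂ := {z | ellipseGauge τ (z - p) ≤ k ^ 2}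

theorem image_closedBall_eq_ellipse {τ k : ℝ} (h0 : 0 ≤ τ) (h1 : τ < 1) (hk : 0 < k) (p : ℂ) :
    (fun w : ℂ => p + (k • ellipseCLM τ) w) '' Metric.closedBall 0 1 = ellipse τ k p := by
  ext z
  simp only [Set.mem_image, ellipse, Set.mem_ofPred_eq, mem_closedBall_zero_iff,
    _root_.smul_apply, ellipseCLM_apply, Complex.real_smul]
  constructor
  · rintro ⟨w, hw, rfl⟩
    rw [add_sub_cancel_left, ellipseGauge_smul, ellipseGauge_ellipseMap h0 h1]
    have : ‖w‖ ^ 2 ≤ 1 := by nlinarith [norm_nonneg w]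
    nlinarith [sq_nonneg k]
  · intro hz
    obtain ⟨w, hw⟩ := exists_ellipseMap_eq h0 h1 ((z - p) / k)
    have hk' : (k : ℂ) ≠ 0 := by exact_mod_cast hk.ne'
    have hzw : (k : ℂ) * ellipseMap τ w = z - p := by rw [hw]; field_simp
    refine ⟨w, ?_, by rw [hzw]; ring⟩
    rw [← hzw, ellipseGauge_smul, ellipseGauge_ellipseMap h0 h1] at hz
    have : ‖w‖ ^ 2 ≤ 1 := by
      have hk2 : 0 < k ^ 2 := by positivity
      nlinarith
    nlinarith [norm_nonneg w]

theorem isCompact_ellipse {τ k : ℝ} (h0 : 0 ≤ τ) (h1 : τ < 1) (hk : 0 < k) (p : ℂ) :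
    IsCompact (ellipse τ k p) := by
  rw [← image_closedBall_eq_ellipse h0 h1 hk p]
  exact (isCompact_closedBall 0 1).image (by fun_prop)

/-- Affine change of variables from the unit disc to an ellipse. -/
theorem ellipse_change_of_variables {τ k : ℝ} (h0 : 0 ≤ τ) (h1 : τ < 1) (hk : 0 < k) (p : ℂ)
    (f : ℂ → ℝ) :
    (IntegrableOn f (ellipse τ k p) →
      IntegrableOn (fun w => f (p + k * ellipseMap τ w)) (Metric.closedBall 0 1)) ∧
    ∫ w in ellipse τ k p, f w
      = k ^ 2 * (1 - τ ^ 2) * ∫ w in Metric.closedBall 0 1, f (p + k * ellipseMap τ w) := by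
  have hd : ∀ w ∈ Metric.closedBall (0 : ℂ) 1, HasFDerivWithinAt
      (fun w : ℂ => p + (k • ellipseCLM τ) w) (k • ellipseCLM τ) (Metric.closedBall 0 1) w :=
    fun w _ => ((k • ellipseCLM τ).hasFDerivAt.const_add p).hasFDerivWithinAt
  have hinj : Set.InjOn (fun w : ℂ => p + (k • ellipseCLM τ) w) (Metric.closedBall 0 1) := by
    intro a _ b _ hab
    simp only [add_right_inj, _root_.smul_apply, ellipseCLM_apply] at hab
    exact ellipseMap_injective h0 h1 (smul_right_injective ℂ hk.ne' hab)
  have hdet : |(k • ellipseCLM τ).det| = k ^ 2 * (1 - τ ^ 2) := by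
    have : (k • ellipseCLM τ).det = k ^ 2 * (1 - τ ^ 2) := by
      rw [← det_ellipseCLM, ContinuousLinearMap.det, ContinuousLinearMap.det,
        ContinuousLinearMap.toLinearMap_smul, LinearMap.det_smul, Complex.finrank_real_complex]
    rw [this, abs_of_pos]
    have : 0 < 1 - τ ^ 2 := by nlinarith
    positivity
  have hpos : k ^ 2 * (1 - τ ^ 2) ≠ 0 := by
    have : 0 < 1 - τ ^ 2 := by nlinarith
    positivity
  have hm : MeasurableSet (Metric.closedBall (0 : ℂ) 1) := Metric.isClosed_closedBall.measurableSet
  have e : ∀ w, p + (k • ellipseCLM τ) w = p + k * ellipseMap τ w := fun w => by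
    rw [_root_.smul_apply, ellipseCLM_apply, Complex.real_smul]
  rw [← image_closedBall_eq_ellipse h0 h1 hk p]
  constructor
  · intro hi
    rw [integrableOn_image_iff_integrableOn_abs_det_fderiv_smul volume hm hd hinj] at hi
    simp only [hdet, e, smul_eq_mul] at hi
    refine (hi.const_mul (k ^ 2 * (1 - τ ^ 2))⁻¹).congr (Eventually.of_forall fun w => ?_)
    simp only
    rw [inv_mul_cancel_left₀ hpos]
  · rw [integral_image_eq_integral_abs_det_fderiv_smul volume hm hd hinj]
    simp only [hdet, e, smul_eq_mul]
    rw [integral_const_mul]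

theorem ball_ae_eq_closedBall (p : ℂ) {r : ℝ} :
    Metric.ball p r =ᵐ[volume] Metric.closedBall p r := by
  rw [← Metric.ball_union_sphere]
  exact (union_ae_eq_left_of_ae_eq_empty (by
    rw [ae_eq_empty]; exact Measure.addHaar_sphere volume p r)).symm

theorem volume_real_ellipse {τ k : ℝ} (h0 : 0 ≤ τ) (h1 : τ < 1) (hk : 0 < k) (p : ℂ) :
    volume.real (ellipse τ k p) = k ^ 2 * (1 - τ ^ 2) * Real.pi := by
  have h := (ellipse_change_of_variables h0 h1 hk p (fun _ => 1)).2
  simp only [integral_const, smul_eq_mul, mul_one, measureReal_restrict_apply_univ] at h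
  rw [h]
  congr 1
  rw [Measure.real, Complex.volume_closedBall]
  simp

/-- The logarithmic potential of an ellipse in terms of its averages over homothetic ellipses. -/
theorem setIntegral_ellipse_log {τ k : ℝ} (h0 : 0 ≤ τ) (h1 : τ < 1) (hk : 0 < k) (p z : ℂ) :
    ∫ w in ellipse τ k p, Real.log ‖z - w‖ = k ^ 2 * (1 - τ ^ 2) * (Real.pi *
      (Real.log k + ∫ s in (0 : ℝ)..1, 2 * s * ellipseAverage τ s ((z - p) / k))) := by
  have hk' : (k : ℂ) ≠ 0 := by exact_mod_cast hk.ne'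
  obtain ⟨hi, he⟩ := ellipse_change_of_variables h0 h1 hk p (fun w => Real.log ‖z - w‖)
  replace hi := hi (integrableOn_log_norm_sub z (isCompact_ellipse h0 h1 hk p).isBounded)
  rw [he]
  congr 1
  have hae : ∀ᵐ w ∂volume.restrict (Metric.closedBall (0 : ℂ) 1),
      Real.log ‖z - (p + k * ellipseMap τ w)‖
        = Real.log k + Real.log ‖(z - p) / k - ellipseMap τ w‖ := by
    obtain ⟨ζ, hζ⟩ := exists_ellipseMap_eq h0 h1 ((z - p) / k)
    refine ae_restrict_of_ae ?_
    have hne : ∀ᵐ w ∂(volume : Measure ℂ), w ≠ ζ := by simp [ae_iff]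
    filter_upwards [hne] with w hw
    have : (z - p) / k - ellipseMap τ w ≠ 0 := by
      rw [← hζ]
      exact fun h => hw (ellipseMap_injective h0 h1 (sub_eq_zero.1 h)).symm
    have e : z - (p + k * ellipseMap τ w) = k * ((z - p) / k - ellipseMap τ w) := by
      field_simp
      ring
    rw [e, norm_mul, Complex.norm_real, Real.norm_of_nonneg hk.le,
      Real.log_mul hk.ne' (norm_ne_zero_iff.2 this)]
  have hc : Integrable (fun _ : ℂ => Real.log k) (volume.restrict (Metric.closedBall (0 : ℂ) 1)) :=
    integrableOn_const measure_closedBall_lt_top.ne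
  have hi2 : IntegrableOn (fun w => Real.log ‖(z - p) / k - ellipseMap τ w‖)
      (Metric.closedBall (0 : ℂ) 1) := by
    refine (Integrable.sub hi hc).congr ?_
    filter_upwards [hae] with w hw
    simp only [Pi.sub_apply]
    rw [hw]
    ring
  have hmeas : Measurable (fun w => Real.log ‖(z - p) / k - ellipseMap τ w‖) := by
    unfold ellipseMap
    have : Measurable (fun w : ℂ => conj w) := Complex.continuous_conj.measurable
    fun_prop
  rw [integral_congr_ae hae, integral_add hc hi2, mul_add]
  congr 1
  · simp [Measure.real, Complex.volume_closedBall]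
  · rw [← setIntegral_congr_set (ball_ae_eq_closedBall 0),
      setIntegral_ball_eq_circleAverage hmeas zero_le_one
      (hi2.mono_set Metric.ball_subset_closedBall)]
    rfl

/-! ### The droplet measure and its effective potential -/

/-- The radius `√((1 - τ²) c)` of the disc removed from the ellipse. -/
def discRadius (τ c : ℝ) : ℝ := Real.sqrt ((1 - τ ^ 2) * c)

/-- The claimed support of the equilibrium measure: the ellipse with the open disc removed. -/
def droplet (τ c : ℝ) (p : ℂ) : Set ℂ := ellipseRegion τ c ∩ (interior (discRegion τ c p))ᶜ

/-- The uniform probability measure on the droplet. -/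
def dropletMeasure (τ c : ℝ) (p : ℂ) : Measure ℂ :=
  ENNReal.ofReal (1 / (Real.pi * (1 - τ ^ 2))) • volume.restrict (droplet τ c p)

/-- The potential with the real logarithm; at `p` it takes a junk value if `c > 0`. -/
def realPotential (τ c : ℝ) (p z : ℂ) : ℝ :=
  ellipticPotential τ z - 2 * c * Real.log ‖z - p‖

section

variable {τ c : ℝ} {p : ℂ}

theorem discRadius_nonneg : 0 ≤ discRadius τ c := Real.sqrt_nonneg _

theorem discRadius_pos (h0 : 0 ≤ τ) (h1 : τ < 1) (hc : 0 < c) : 0 < discRadius τ c :=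
  Real.sqrt_pos.2 (mul_pos (by nlinarith) hc)

theorem sq_discRadius (h0 : 0 ≤ τ) (h1 : τ < 1) (hc : 0 ≤ c) :
    discRadius τ c ^ 2 = (1 - τ ^ 2) * c :=
  Real.sq_sqrt (mul_nonneg (by nlinarith) hc)

theorem discRegion_eq (h0 : 0 ≤ τ) (h1 : τ < 1) (hc : 0 ≤ c) :
    discRegion τ c p = Metric.closedBall p (discRadius τ c) := by
  ext z
  rw [Metric.mem_closedBall, dist_eq_norm, ← sq_le_sq₀ (norm_nonneg _) discRadius_nonneg,
    sq_discRadius h0 h1 hc, ← Complex.normSq_eq_norm_sq, Complex.normSq_apply, Complex.sub_re,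
    Complex.sub_im, ← sq, ← sq]
  rfl

theorem interior_discRegion (h0 : 0 ≤ τ) (h1 : τ < 1) (hc : 0 ≤ c) :
    interior (discRegion τ c p) = Metric.ball p (discRadius τ c) := by
  rw [discRegion_eq h0 h1 hc]
  by_cases h : discRadius τ c = 0
  · rw [h]; simp
  · exact interior_closedBall p h

theorem ellipseRegion_eq (hc : 0 ≤ c) : ellipseRegion τ c = ellipse τ (Real.sqrt (1 + c)) 0 := by
  ext z
  simp [ellipse, ellipseGauge, ellipseRegion, Real.sq_sqrt (show 0 ≤ 1 + c by linarith)]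

theorem isCompact_ellipseRegion (h0 : 0 ≤ τ) (h1 : τ < 1) (hc : 0 ≤ c) :
    IsCompact (ellipseRegion τ c) := by
  rw [ellipseRegion_eq hc]
  exact isCompact_ellipse h0 h1 (Real.sqrt_pos.2 (by linarith)) 0

theorem isCompact_droplet (h0 : 0 ≤ τ) (h1 : τ < 1) (hc : 0 ≤ c) :
    IsCompact (droplet τ c p) :=
  (isCompact_ellipseRegion h0 h1 hc).inter_right isOpen_interior.isClosed_compl

theorem measurableSet_droplet (h0 : 0 ≤ τ) (h1 : τ < 1) (hc : 0 ≤ c) :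
    MeasurableSet (droplet τ c p) := (isCompact_droplet h0 h1 hc).isClosed.measurableSet

theorem ellipse_zero_eq_closedBall {r : ℝ} (hr : 0 ≤ r) (p : ℂ) :
    ellipse 0 r p = Metric.closedBall p r := by
  ext z
  rw [Metric.mem_closedBall, dist_eq_norm, ← sq_le_sq₀ (norm_nonneg _) hr,
    ← Complex.normSq_eq_norm_sq, Complex.normSq_apply, ← sq, ← sq]
  simp [ellipse, ellipseGauge]

theorem integral_dropletMeasure (h0 : 0 ≤ τ) (h1 : τ < 1) (hc : 0 ≤ c)
    (hsub : discRegion τ c p ⊆ ellipseRegion τ c) {f : ℂ → ℝ}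
    (hf : IntegrableOn f (ellipseRegion τ c)) :
    ∫ w, f w ∂dropletMeasure τ c p = (Real.pi * (1 - τ ^ 2))⁻¹ *
      ((∫ w in ellipse τ (Real.sqrt (1 + c)) 0, f w)
        - ∫ w in ellipse 0 (discRadius τ c) p, f w) := by
  have hpos : 0 < Real.pi * (1 - τ ^ 2) := mul_pos Real.pi_pos (by nlinarith)
  rw [dropletMeasure, integral_smul_measure, ENNReal.toReal_ofReal (by positivity), smul_eq_mul,
    one_div]
  congr 1
  rw [ellipse_zero_eq_closedBall discRadius_nonneg,
    ← setIntegral_congr_set (ball_ae_eq_closedBall p),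
    ← interior_discRegion h0 h1 hc, ← ellipseRegion_eq hc]
  exact setIntegral_sdiff isOpen_interior.measurableSet hf (interior_subset.trans hsub)

theorem isProbabilityMeasure_dropletMeasure (h0 : 0 ≤ τ) (h1 : τ < 1) (hc : 0 ≤ c)
    (hsub : discRegion τ c p ⊆ ellipseRegion τ c) :
    IsProbabilityMeasure (dropletMeasure τ c p) := by
  have hpos : 0 < 1 - τ ^ 2 := by nlinarith
  have hK := isCompact_ellipseRegion h0 h1 hc
  have hfin : IsFiniteMeasure (dropletMeasure τ c p) := by
    have : IsFiniteMeasure (volume.restrict (droplet τ c p)) :=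
      ⟨by
        rw [Measure.restrict_apply_univ]
        exact (isCompact_droplet h0 h1 hc).measure_lt_top⟩
    unfold dropletMeasure
    exact Measure.smul_finite _ ENNReal.ofReal_ne_top
  have h := integral_dropletMeasure (p := p) h0 h1 hc hsub (f := fun _ => 1)
    (integrableOn_const hK.measure_lt_top.ne)
  simp only [integral_const, smul_eq_mul, mul_one, measureReal_restrict_apply_univ] at h
  rw [volume_real_ellipse h0 h1 (Real.sqrt_pos.2 (by linarith)),
    Real.sq_sqrt (by linarith)] at h
  have hdisc : volume.real (ellipse 0 (discRadius τ c) p) = (1 - τ ^ 2) * c * Real.pi := by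
    rw [ellipse_zero_eq_closedBall discRadius_nonneg, Measure.real, Complex.volume_closedBall,
      ← ENNReal.ofReal_pow discRadius_nonneg, sq_discRadius h0 h1 hc]
    rw [ENNReal.toReal_mul, ENNReal.toReal_ofReal (by positivity)]
    simp
  rw [hdisc] at h
  rw [isProbabilityMeasure_iff_real, h]
  have := Real.pi_pos
  field_simp
  ring

theorem integrable_dropletMeasure {f : ℂ → ℝ}
    (hf : IntegrableOn f (ellipseRegion τ c)) : Integrable f (dropletMeasure τ c p) :=
  Integrable.smul_measure (hf.mono_set Set.inter_subset_left) ENNReal.ofReal_ne_top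

theorem integrable_log_dropletMeasure (h0 : 0 ≤ τ) (h1 : τ < 1) (hc : 0 ≤ c) (z : ℂ) :
    Integrable (fun w => Real.log ‖z - w‖) (dropletMeasure τ c p) :=
  integrable_dropletMeasure
    (integrableOn_log_norm_sub z (isCompact_ellipseRegion h0 h1 hc).isBounded)

theorem integral_log_dropletMeasure (h0 : 0 ≤ τ) (h1 : τ < 1) (hc : 0 ≤ c)
    (hsub : discRegion τ c p ⊆ ellipseRegion τ c) (z : ℂ) :
    ∫ w, Real.log ‖z - w‖ ∂dropletMeasure τ c p
      = (1 + c) * (Real.log (Real.sqrt (1 + c)) +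
          ∫ s in (0 : ℝ)..1, 2 * s * ellipseAverage τ s (z / Real.sqrt (1 + c)))
        - c * (Real.log (discRadius τ c) +
          ∫ s in (0 : ℝ)..1, 2 * s * ellipseAverage 0 s ((z - p) / discRadius τ c)) := by
  have hpos : 0 < 1 - τ ^ 2 := by nlinarith
  have hpi := Real.pi_pos
  rw [integral_dropletMeasure h0 h1 hc hsub
    (integrableOn_log_norm_sub z (isCompact_ellipseRegion h0 h1 hc).isBounded),
    setIntegral_ellipse_log h0 h1 (Real.sqrt_pos.2 (by linarith)), Real.sq_sqrt (by linarith),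
    sub_zero]
  rcases hc.eq_or_lt with rfl | hc'
  · have : ellipse 0 (discRadius τ 0) p = {p} := by
      rw [ellipse_zero_eq_closedBall discRadius_nonneg]
      simp [discRadius]
    rw [this, Measure.restrict_eq_zero.2 (by simp), integral_zero_measure]
    field_simp
    ring
  · rw [setIntegral_ellipse_log le_rfl one_pos (discRadius_pos h0 h1 hc'), sq_discRadius h0 h1 hc]
    field_simp
    ring

theorem ellipticPotential_div (τ : ℝ) {k : ℝ} (hk : k ≠ 0) (z : ℂ) :
    k ^ 2 * ellipticPotential τ (z / k) = ellipticPotential τ z := by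
  have : (z / k) ^ 2 = ((k ^ 2)⁻¹ : ℝ) * z ^ 2 := by push_cast; field_simp
  rw [ellipticPotential, ellipticPotential, this, Complex.re_ofReal_mul, norm_div,
    Complex.norm_real, div_pow, Real.norm_eq_abs, sq_abs]
  field_simp

/-- The point charge and the removed disc balance outside the disc, while inside the disc the
point charge dominates. -/
theorem log_norm_le_log_add_integral {r : ℝ} (hr : 0 < r) {x : ℂ} (hx : x ≠ 0) :
    Real.log ‖x‖ ≤ Real.log r + ∫ s in (0 : ℝ)..1, 2 * s * ellipseAverage 0 s (x / r) := by
  have hxp : 0 < ‖x‖ := norm_pos_iff.2 hx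
  have hn : ‖x / r‖ = ‖x‖ / r := by rw [norm_div, Complex.norm_real, Real.norm_of_nonneg hr.le]
  have hlog : Real.log ‖x‖ = Real.log r + Real.log ‖x / r‖ := by
    rw [hn, Real.log_div hxp.ne' hr.ne']; ring
  rw [hlog, add_le_add_iff_left]
  rcases le_or_gt 1 ‖x / r‖ with h | h
  · rw [integral_ellipseAverage_zero h]
  · have hp : 0 < ‖x / r‖ := by rw [hn]; positivity
    have hg : ellipseGauge 0 (x / r) ≤ 1 := by
      have : ellipseGauge 0 (x / r) = ‖x / r‖ ^ 2 := by
        simpa [ellipseMap] using ellipseGauge_ellipseMap le_rfl one_pos (x / r)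
      rw [this]
      nlinarith
    rw [integral_ellipseAverage_of_le le_rfl one_pos hg]
    have h2 := Real.log_le_sub_one_of_pos (pow_pos hp 2)
    rw [Real.log_pow] at h2
    simp [ellipticPotential] at h2 ⊢
    linarith

/-- The Euler–Lagrange inequality: the effective potential of the droplet measure is bounded below
by a constant off the point charge, and equals that constant on the droplet. -/
theorem effectivePotential (h0 : 0 ≤ τ) (h1 : τ < 1) (hc : 0 ≤ c)
    (hsub : discRegion τ c p ⊆ ellipseRegion τ c) :
    ∃ F : ℝ,
      (∀ z, (0 < c → z ≠ p) → F ≤ realPotential τ c p z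
        - 2 * ∫ w, Real.log ‖z - w‖ ∂dropletMeasure τ c p) ∧
      ∀ z ∈ droplet τ c p, realPotential τ c p z
        - 2 * ∫ w, Real.log ‖z - w‖ ∂dropletMeasure τ c p = F := by
  set k := Real.sqrt (1 + c) with hk
  have hk0 : 0 < k := Real.sqrt_pos.2 (by linarith)
  have hk2 : k ^ 2 = 1 + c := Real.sq_sqrt (by linarith)
  have hr : 0 < c → 0 < discRadius τ c := discRadius_pos h0 h1
  refine ⟨(1 + c) * (1 - 2 * Real.log k), fun z hz => ?_, fun z hz => ?_⟩
  · rw [integral_log_dropletMeasure h0 h1 hc hsub, ← hk, realPotential,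
      ← ellipticPotential_div τ hk0.ne' z, hk2]
    have e1 := integral_ellipseAverage_le h0 h1 (z / k)
    have e2 : c * Real.log ‖z - p‖ ≤ c * (Real.log (discRadius τ c) +
          ∫ s in (0 : ℝ)..1, 2 * s * ellipseAverage 0 s ((z - p) / discRadius τ c)) := by
      rcases hc.eq_or_lt with h | h
      · rw [← h, zero_mul, zero_mul]
      · exact mul_le_mul_of_nonneg_left
          (log_norm_le_log_add_integral (hr h) (sub_ne_zero.2 (hz h))) hc
    have e3 := mul_le_mul_of_nonneg_left e1 (show 0 ≤ 1 + c by linarith)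
    linarith
  · rw [integral_log_dropletMeasure h0 h1 hc hsub, ← hk, realPotential,
      ← ellipticPotential_div τ hk0.ne' z, hk2]
    have hg : ellipseGauge τ (z / k) ≤ 1 := by
      have h2 := ellipseGauge_smul τ k (z / k)
      rw [mul_div_cancel₀ z (by exact_mod_cast hk0.ne' : (k : ℂ) ≠ 0)] at h2
      have h3 : ellipseGauge τ z ≤ 1 + c := hz.1
      rw [h2, hk2] at h3
      nlinarith
    have e1 := integral_ellipseAverage_of_le h0 h1 hg
    have e2 : c * Real.log ‖z - p‖ = c * (Real.log (discRadius τ c) +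
          ∫ s in (0 : ℝ)..1, 2 * s * ellipseAverage 0 s ((z - p) / discRadius τ c)) := by
      rcases hc.eq_or_lt with h | h
      · rw [← h, zero_mul, zero_mul]
      · have hr0 := hr h
        have h4 : discRadius τ c ≤ ‖z - p‖ := by
          have := hz.2
          rw [interior_discRegion h0 h1 hc, Set.mem_compl_iff, Metric.mem_ball, not_lt,
            dist_eq_norm] at this
          exact this
        have h5 : ‖(z - p) / discRadius τ c‖ = ‖z - p‖ / discRadius τ c := by
          rw [norm_div, Complex.norm_real, Real.norm_of_nonneg hr0.le]
        rw [integral_ellipseAverage_zero (by rw [h5, one_le_div hr0]; exact h4), h5,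
          Real.log_div (hr0.trans_le h4).ne' hr0.ne']
        ring
    rw [e1]
    linarith

end

/-! ### Extended-real integrals -/

section

variable {X : Type*} [MeasurableSpace X] {m : Measure X}

theorem eintegral_congr_ae {f g : X → EReal} (h : f =ᵐ[m] g) : eintegral m f = eintegral m g := by
  unfold eintegral
  rw [lintegral_congr_ae (h.mono fun x hx => by rw [hx]),
    lintegral_congr_ae (f := fun x => (-f x).toENNReal) (g := fun x => (-g x).toENNReal)
      (h.mono fun x hx => by simp only [hx])]

theorem eintegral_coe {g : X → ℝ} (hg : Integrable g m) :
    eintegral m (fun x => (g x : EReal)) = ((∫ x, g x ∂m : ℝ) : EReal) := by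
  have h1 : ∫⁻ x, ENNReal.ofReal (g x) ∂m ≠ ⊤ := hg.lintegral_lt_top.ne
  have h2 : ∫⁻ x, ENNReal.ofReal (-g x) ∂m ≠ ⊤ := hg.neg.lintegral_lt_top.ne
  rw [integral_eq_lintegral_pos_part_sub_lintegral_neg_part hg, eintegral]
  simp only [← EReal.coe_neg, EReal.real_coe_toENNReal]
  rw [EReal.coe_sub, EReal.coe_ennreal_toReal h1, EReal.coe_ennreal_toReal h2]

/-- For an extended-real function that is `⊤` on `N`, real off `N` and bounded below, a finite
integral is an ordinary one: `N` is a null set and the real part is integrable. -/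
theorem integrable_of_eintegral_ne_top [IsFiniteMeasure m] {f : X → EReal} {g : X → ℝ} {N : Set X}
    (hN : MeasurableSet N) (hfN : ∀ x ∈ N, f x = ⊤) (hfg : ∀ x ∉ N, f x = g x)
    (hg : Measurable g) {C : ℝ} (hC : ∀ᵐ x ∂m, -C ≤ g x) :
    eintegral m f ≠ ⊥ ∧ (eintegral m f ≠ ⊤ →
      m N = 0 ∧ Integrable g m ∧ eintegral m f = ((∫ x, g x ∂m : ℝ) : EReal)) := by
  have hneg : ∫⁻ x, (-f x).toENNReal ∂m ≠ ⊤ := by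
    refine ne_top_of_le_ne_top (b := ∫⁻ _, ENNReal.ofReal C ∂m) ?_ (lintegral_mono_ae ?_)
    · rw [lintegral_const]
      exact ENNReal.mul_ne_top ENNReal.ofReal_ne_top (measure_ne_top _ _)
    · filter_upwards [hC] with x hx
      by_cases hxN : x ∈ N
      · rw [hfN x hxN]; simp
      · rw [hfg x hxN, ← EReal.coe_neg, EReal.real_coe_toENNReal]
        exact ENNReal.ofReal_le_ofReal (by linarith)
  have hneg' : ((∫⁻ x, (-f x).toENNReal ∂m : ℝ≥0∞) : EReal) ≠ ⊤ := by
    rwa [Ne, EReal.coe_ennreal_eq_top_iff]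
  constructor
  · rw [eintegral, sub_eq_add_neg, EReal.add_ne_bot_iff]
    exact ⟨EReal.coe_ennreal_ne_bot _, by rwa [Ne, EReal.neg_eq_bot_iff]⟩
  intro hfin
  have hpos : ∫⁻ x, (f x).toENNReal ∂m ≠ ⊤ := by
    intro h
    apply hfin
    rw [eintegral, h, EReal.coe_ennreal_top, EReal.top_sub hneg']
  have hN0 : m N = 0 := by
    by_contra hne
    apply hpos
    rw [eq_top_iff]
    calc (⊤ : ℝ≥0∞) = ⊤ * m N := (ENNReal.top_mul hne).symm
      _ = ∫⁻ x in N, (f x).toENNReal ∂m := by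
        rw [← setLIntegral_const]
        refine setLIntegral_congr_fun hN fun x hx => ?_
        simp only [hfN x hx, EReal.toENNReal_top]
      _ ≤ _ := setLIntegral_le_lintegral _ _
  have hae : f =ᵐ[m] fun x => (g x : EReal) := by
    filter_upwards [measure_eq_zero_iff_ae_notMem.1 hN0] with x hx using hfg x hx
  have hgi : Integrable g m := by
    refine ⟨hg.aestronglyMeasurable, ?_⟩
    have e1 : ∫⁻ x, (f x).toENNReal ∂m = ∫⁻ x, ENNReal.ofReal (g x) ∂m :=
      lintegral_congr_ae (hae.mono fun x hx => by simp only [hx, EReal.real_coe_toENNReal])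
    have e2 : ∫⁻ x, (-f x).toENNReal ∂m = ∫⁻ x, ENNReal.ofReal (-g x) ∂m :=
      lintegral_congr_ae (hae.mono fun x hx => by
        simp only [hx, ← EReal.coe_neg, EReal.real_coe_toENNReal])
    rw [hasFiniteIntegral_iff_norm]
    refine lt_of_le_of_lt (lintegral_mono
      (g := fun x => ENNReal.ofReal (g x) + ENNReal.ofReal (-g x)) fun x => ?_) ?_
    · rcases le_total 0 (g x) with h | h
      · simp only [Real.norm_of_nonneg h]; exact le_self_add
      · simp only [Real.norm_of_nonpos h]; exact le_add_self
    · rw [lintegral_add_left (by fun_prop)]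
      exact ENNReal.add_lt_top.2 ⟨e1 ▸ hpos.lt_top, e2 ▸ hneg.lt_top⟩
  exact ⟨hN0, hgi, by rw [eintegral_congr_ae hae, eintegral_coe hgi]⟩

end

/-! ### Measures of finite weighted energy -/

theorem log_enorm {x : ℂ} (hx : x ≠ 0) : ENNReal.log ‖x‖ₑ = (Real.log ‖x‖ : ℝ) := by
  rw [← ofReal_norm, ENNReal.log_ofReal_of_pos (norm_pos_iff.2 hx)]

theorem logKernel_of_ne {z w : ℂ} (h : z ≠ w) :
    logKernel z w = ((-Real.log ‖z - w‖ : ℝ) : EReal) := by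
  rw [logKernel, log_enorm (sub_ne_zero.2 h), EReal.coe_neg]

theorem logKernel_self (z : ℂ) : logKernel z z = ⊤ := by simp [logKernel]

theorem potential_of_ne {τ c : ℝ} {p z : ℂ} (h : z ≠ p ∨ c = 0) :
    potential τ c p z = (realPotential τ c p z : EReal) := by
  by_cases hz : z = p
  · obtain rfl : c = 0 := h.resolve_left (not_not.2 hz)
    simp [potential, realPotential, ellipticPotential]
  · rw [potential, log_enorm (sub_ne_zero.2 hz), ← EReal.coe_mul, ← EReal.coe_sub]
    rfl

theorem potential_self {τ c : ℝ} (p : ℂ) (hc : 0 < c) : potential τ c p p = ⊤ := by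
  rw [potential, sub_self, enorm_zero, ENNReal.log_zero,
    EReal.coe_mul_bot_of_pos (by linarith), EReal.coe_sub_bot]

theorem IsAdmissible.exists_ae_norm_le {ν : Measure ℂ} (hν : IsAdmissible ν) :
    ∃ R, 0 ≤ R ∧ ∀ᵐ z ∂ν, ‖z‖ ≤ R := by
  obtain ⟨R, hR⟩ := hν.2.isBounded.subset_closedBall 0
  refine ⟨max R 0, le_max_right _ _, ?_⟩
  filter_upwards [Measure.support_mem_ae (μ := ν)] with z hz
  exact (mem_closedBall_zero_iff.1 (hR hz)).trans (le_max_left _ _)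

/-- A compactly supported probability measure of finite weighted energy has finite logarithmic
self-energy and a finite external energy, and its weighted energy is given by ordinary integrals. -/
theorem weightedEnergy_of_ne_top {τ c : ℝ} {p : ℂ} (h0 : 0 ≤ τ) (h1 : τ < 1) (hc : 0 ≤ c)
    {ν : Measure ℂ} (hν : IsAdmissible ν) (hfin : weightedEnergy (potential τ c p) ν ≠ ⊤) :
    (∀ᵐ q ∂(ν.prod ν), q.1 ≠ q.2) ∧
    Integrable (fun q : ℂ × ℂ => Real.log ‖q.1 - q.2‖) (ν.prod ν) ∧
    (∀ᵐ z ∂ν, 0 < c → z ≠ p) ∧ Integrable (realPotential τ c p) ν ∧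
    weightedEnergy (potential τ c p) ν = ((-(∫ q, Real.log ‖q.1 - q.2‖ ∂(ν.prod ν))
      + ∫ z, realPotential τ c p z ∂ν : ℝ) : EReal) := by
  have := hν.1
  obtain ⟨R, hR0, hR⟩ := hν.exists_ae_norm_le
  have hmeas : Measurable (realPotential τ c p) := by
    unfold realPotential ellipticPotential
    have : Measurable fun z : ℂ => (z ^ 2).re := Complex.measurable_re.comp (by fun_prop)
    fun_prop
  obtain ⟨kb, kt⟩ := integrable_of_eintegral_ne_top (m := ν.prod ν)
    (f := fun q => logKernel q.1 q.2) (g := fun q => -Real.log ‖q.1 - q.2‖)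
    (N := Set.diagonal ℂ) (C := R + R) isClosed_diagonal.measurableSet
    (by rintro ⟨z, w⟩ h; obtain rfl : z = w := h; exact logKernel_self z)
    (fun q hq => logKernel_of_ne hq) (by fun_prop) (by
      filter_upwards [Measure.quasiMeasurePreserving_fst.ae hR,
        Measure.quasiMeasurePreserving_snd.ae hR] with q h1 h2
      have h3 := Real.log_le_self (norm_nonneg (q.1 - q.2))
      have h4 := norm_sub_le q.1 q.2
      linarith)
  obtain ⟨pb, pt⟩ := integrable_of_eintegral_ne_top (m := ν)
    (f := potential τ c p) (g := realPotential τ c p)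
    (N := {z | z = p ∧ 0 < c}) (C := 2 * c * (R + ‖p‖))
    ((measurableSet_eq).inter (MeasurableSet.const _))
    (by rintro z ⟨rfl, h⟩; exact potential_self z h)
    (fun z hz => potential_of_ne (by
      by_contra! h
      exact hz ⟨h.1, lt_of_le_of_ne hc h.2.symm⟩)) hmeas (by
      filter_upwards [hR] with z hz
      have h3 := Real.log_le_self (norm_nonneg (z - p))
      have h4 := norm_sub_le z p
      have h5 : 0 ≤ ellipticPotential τ z := by
        rw [ellipticPotential_eq h0 h1]
        have : 0 < 1 - τ := by linarith
        positivity
      have h6 := mul_le_mul_of_nonneg_left (h3.trans (h4.trans (add_le_add_left hz _)))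
        (show 0 ≤ 2 * c by linarith)
      simp only [realPotential]
      linarith)
  have hk : eintegral (ν.prod ν) (fun q => logKernel q.1 q.2) ≠ ⊤ := fun h => hfin (by
    rw [weightedEnergy, h, EReal.top_add_of_ne_bot pb])
  have hp : eintegral ν (potential τ c p) ≠ ⊤ := fun h => hfin (by
    rw [weightedEnergy, h, EReal.add_top_of_ne_bot kb])
  obtain ⟨k1, k2, k3⟩ := kt hk
  obtain ⟨p1, p2, p3⟩ := pt hp
  refine ⟨measure_eq_zero_iff_ae_notMem.1 k1, by simpa using k2.neg, ?_, p2, ?_⟩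
  · filter_upwards [measure_eq_zero_iff_ae_notMem.1 p1] with z hz h0 hzp using hz ⟨hzp, h0⟩
  · rw [weightedEnergy, k3, p3, integral_neg, EReal.coe_add]

/-! ### The droplet measure minimises the energy -/

section

variable {τ c : ℝ} {p : ℂ}

theorem dropletMeasure_absolutelyContinuous : dropletMeasure τ c p ≪ volume :=
  (Measure.smul_absolutelyContinuous).trans Measure.restrict_le_self.absolutelyContinuous

theorem ae_mem_droplet (h0 : 0 ≤ τ) (h1 : τ < 1) (hc : 0 ≤ c) :
    ∀ᵐ z ∂dropletMeasure τ c p, z ∈ droplet τ c p :=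
  Measure.smul_absolutelyContinuous.ae_le (ae_restrict_mem (measurableSet_droplet h0 h1 hc))

theorem ae_ne_dropletMeasure (z : ℂ) : ∀ᵐ w ∂dropletMeasure τ c p, z ≠ w := by
  refine dropletMeasure_absolutelyContinuous.ae_le ?_
  have : ∀ᵐ w ∂(volume : Measure ℂ), w ≠ z := by simp [ae_iff]
  filter_upwards [this] with w hw using hw.symm

theorem isAdmissible_dropletMeasure (h0 : 0 ≤ τ) (h1 : τ < 1) (hc : 0 ≤ c)
    (hsub : discRegion τ c p ⊆ ellipseRegion τ c) : IsAdmissible (dropletMeasure τ c p) :=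
  ⟨isProbabilityMeasure_dropletMeasure h0 h1 hc hsub,
    (isCompact_droplet h0 h1 hc).of_isClosed_subset Measure.isClosed_support
      (Measure.support_subset_of_isClosed (isCompact_droplet h0 h1 hc).isClosed
        (ae_mem_droplet h0 h1 hc))⟩

theorem ae_ne_prod_dropletMeasure (h0 : 0 ≤ τ) (h1 : τ < 1) (hc : 0 ≤ c)
    (hsub : discRegion τ c p ⊆ ellipseRegion τ c) (ν : Measure ℂ) [IsProbabilityMeasure ν] :
    ∀ᵐ q ∂(ν.prod (dropletMeasure τ c p)), q.1 ≠ q.2 := by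
  have := isProbabilityMeasure_dropletMeasure h0 h1 hc hsub
  exact (Measure.ae_prod_iff_ae_ae isClosed_diagonal.measurableSet.compl).2
    (Eventually.of_forall fun z => ae_ne_dropletMeasure z)

/-- The potential of the droplet measure for the kernel `|log |z - w||` is locally bounded, so its
mutual logarithmic energy with any compactly supported measure is finite. -/
theorem integrable_log_prod_dropletMeasure (h0 : 0 ≤ τ) (h1 : τ < 1) (hc : 0 ≤ c)
    (hsub : discRegion τ c p ⊆ ellipseRegion τ c) {ν : Measure ℂ} (hν : IsAdmissible ν) :
    Integrable (fun q : ℂ × ℂ => Real.log ‖q.1 - q.2‖) (ν.prod (dropletMeasure τ c p)) := by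
  have := hν.1
  have := isProbabilityMeasure_dropletMeasure h0 h1 hc hsub
  obtain ⟨R, hR0, hR⟩ := hν.exists_ae_norm_le
  obtain ⟨R', hR'⟩ := (isCompact_droplet (p := p) h0 h1 hc).isBounded.subset_closedBall 0
  have hm : AEStronglyMeasurable (fun q : ℂ × ℂ => Real.log ‖q.1 - q.2‖)
      (ν.prod (dropletMeasure τ c p)) := Measurable.aestronglyMeasurable (by fun_prop)
  rw [integrable_prod_iff hm]
  refine ⟨Eventually.of_forall fun z => integrable_log_dropletMeasure h0 h1 hc z, ?_⟩
  set a : ℝ≥0∞ := ENNReal.ofReal (1 / (Real.pi * (1 - τ ^ 2)))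
  set ρ := R + R' + 1
  refine Integrable.mono' (integrable_const (a.toReal • ∫ w in Metric.ball (0 : ℂ) ρ,
    ‖Real.log ‖w‖‖)) hm.norm.integral_prod_right' ?_
  filter_upwards [hR] with z hz
  rw [Real.norm_of_nonneg (integral_nonneg fun _ => norm_nonneg _), dropletMeasure,
    integral_smul_measure]
  refine smul_le_smul_of_nonneg_left ?_ ENNReal.toReal_nonneg
  have hmp := Measure.measurePreserving_sub_left (volume : Measure ℂ) z
  have e := hmp.setIntegral_preimage_emb (Homeomorph.subLeft z).measurableEmbedding
    (fun w => ‖Real.log ‖w‖‖) (Metric.ball 0 ρ)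
  rw [preimage_sub_left_ball] at e
  rw [← e]
  refine setIntegral_mono_set (integrableOn_log_norm_sub z Metric.isBounded_ball).norm
    (Eventually.of_forall fun _ => norm_nonneg _) (LE.le.eventuallyLE fun w hw => ?_)
  rw [mem_ball_iff_norm']
  have h2 := mem_closedBall_zero_iff.1 (hR' hw)
  have h3 := norm_sub_le z w
  simp only [ρ]
  linarith

theorem integrable_realPotential_dropletMeasure (h0 : 0 ≤ τ) (h1 : τ < 1) (hc : 0 ≤ c) :
    Integrable (realPotential τ c p) (dropletMeasure τ c p) := by
  refine integrable_dropletMeasure (Integrable.sub ?_ (Integrable.const_mul ?_ _))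
  · refine ContinuousOn.integrableOn_compact (isCompact_ellipseRegion h0 h1 hc)
      (Continuous.continuousOn ?_)
    unfold ellipticPotential
    have : Continuous fun z : ℂ => (z ^ 2).re := Complex.continuous_re.comp (by fun_prop)
    fun_prop
  · have := integrableOn_log_norm_sub p (isCompact_ellipseRegion h0 h1 hc).isBounded
    simpa only [norm_sub_rev p, IntegrableOn] using this

theorem weightedEnergy_dropletMeasure (h0 : 0 ≤ τ) (h1 : τ < 1) (hc : 0 ≤ c)
    (hsub : discRegion τ c p ⊆ ellipseRegion τ c) :
    weightedEnergy (potential τ c p) (dropletMeasure τ c p)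
      = ((-(∫ q, Real.log ‖q.1 - q.2‖ ∂((dropletMeasure τ c p).prod (dropletMeasure τ c p)))
        + ∫ z, realPotential τ c p z ∂dropletMeasure τ c p : ℝ) : EReal) := by
  have hμ := isAdmissible_dropletMeasure h0 h1 hc hsub
  have := hμ.1
  have hi : Integrable (fun q : ℂ × ℂ => -Real.log ‖q.1 - q.2‖) _ :=
    (integrable_log_prod_dropletMeasure h0 h1 hc hsub hμ).neg
  rw [weightedEnergy, eintegral_congr_ae (g := fun q : ℂ × ℂ =>
      ((-Real.log ‖q.1 - q.2‖ : ℝ) : EReal)) (by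
    filter_upwards [ae_ne_prod_dropletMeasure h0 h1 hc hsub (dropletMeasure τ c p)] with q hq
      using logKernel_of_ne hq), eintegral_coe hi,
    eintegral_congr_ae (g := fun z => (realPotential τ c p z : EReal)) (by
      filter_upwards [ae_ne_dropletMeasure (τ := τ) (c := c) p] with z hz
        using potential_of_ne (Or.inl hz.symm)),
    eintegral_coe (integrable_realPotential_dropletMeasure h0 h1 hc), ← EReal.coe_add,
    integral_neg]

/-- The droplet measure minimises the weighted energy, and any measure of the same energy coincides
with it: the excess energy is the logarithmic energy of the difference plus the integral of the
excess of the effective potential. -/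
theorem weightedEnergy_dropletMeasure_le (h0 : 0 ≤ τ) (h1 : τ < 1) (hc : 0 ≤ c)
    (hsub : discRegion τ c p ⊆ ellipseRegion τ c) {ν : Measure ℂ} (hν : IsAdmissible ν) :
    weightedEnergy (potential τ c p) (dropletMeasure τ c p)
        ≤ weightedEnergy (potential τ c p) ν ∧
      (weightedEnergy (potential τ c p) ν
        ≤ weightedEnergy (potential τ c p) (dropletMeasure τ c p) → ν = dropletMeasure τ c p) := by
  have hμ := isAdmissible_dropletMeasure h0 h1 hc hsub
  have hμE := weightedEnergy_dropletMeasure h0 h1 hc hsub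
  by_cases hfin : weightedEnergy (potential τ c p) ν = ⊤
  · rw [hfin, hμE]
    exact ⟨le_top, fun h => absurd (top_le_iff.1 h) (EReal.coe_ne_top _)⟩
  have := hν.1
  have := hμ.1
  obtain ⟨dνν, iνν, hp, iQ, hνE⟩ := weightedEnergy_of_ne_top h0 h1 hc hν hfin
  have iμμ := integrable_log_prod_dropletMeasure h0 h1 hc hsub hμ
  have iνμ := integrable_log_prod_dropletMeasure h0 h1 hc hsub hν
  have iQμ := integrable_realPotential_dropletMeasure (p := p) h0 h1 hc
  obtain ⟨hpos, hzero⟩ := logEnergy_sub_nonneg ν (dropletMeasure τ c p) iνν iμμ iνμ dνν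
    (ae_ne_prod_dropletMeasure h0 h1 hc hsub _) (ae_ne_prod_dropletMeasure h0 h1 hc hsub _)
  obtain ⟨F, hF, hFeq⟩ := effectivePotential h0 h1 hc hsub
  have hνF : F ≤ (∫ z, realPotential τ c p z ∂ν)
      - 2 * ∫ q, Real.log ‖q.1 - q.2‖ ∂(ν.prod (dropletMeasure τ c p)) := by
    rw [integral_prod _ iνμ, ← integral_const_mul, ← integral_sub iQ
      (iνμ.integral_prod_left.const_mul 2)]
    have h := integral_mono_ae (μ := ν) (integrable_const F)
      (iQ.sub (iνμ.integral_prod_left.const_mul 2)) (by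
        filter_upwards [hp] with z hz using hF z hz)
    simpa using h
  have hμF : (∫ z, realPotential τ c p z ∂dropletMeasure τ c p)
      - 2 * ∫ q, Real.log ‖q.1 - q.2‖ ∂((dropletMeasure τ c p).prod (dropletMeasure τ c p))
      = F := by
    rw [integral_prod _ iμμ, ← integral_const_mul, ← integral_sub iQμ
      (iμμ.integral_prod_left.const_mul 2), integral_congr_ae (g := fun _ => F) (by
        filter_upwards [ae_mem_droplet h0 h1 hc] with z hz using hFeq z hz)]
    simp
  rw [hνE, hμE, EReal.coe_le_coe_iff, EReal.coe_le_coe_iff]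
  exact ⟨by linarith, fun h => hzero (by linarith)⟩

end

/-! ### The support of the droplet measure -/

section

variable {τ c : ℝ} {p : ℂ}

theorem continuous_ellipseGauge (τ : ℝ) : Continuous (ellipseGauge τ) := by
  unfold ellipseGauge; fun_prop

/-- The parametrisation of the boundary of the elliptic region. -/
def boundaryCurve (τ c θ : ℝ) : ℂ :=
  ⟨Real.sqrt (1 + c) * (1 + τ) * Real.cos θ, Real.sqrt (1 + c) * (1 - τ) * Real.sin θ⟩

theorem continuous_boundaryCurve (τ c : ℝ) : Continuous (boundaryCurve τ c) := by
  have : boundaryCurve τ c = fun θ : ℝ =>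
      ((Real.sqrt (1 + c) * (1 + τ) * Real.cos θ : ℝ) : ℂ)
        + ((Real.sqrt (1 + c) * (1 - τ) * Real.sin θ : ℝ) : ℂ) * Complex.I := by
    ext θ
    exact Complex.mk_eq_add_mul_I _ _
  rw [this]
  fun_prop

theorem ellipseGauge_boundaryCurve (h0 : 0 ≤ τ) (h1 : τ < 1) (hc : 0 ≤ c) (θ : ℝ) :
    ellipseGauge τ (boundaryCurve τ c θ) = 1 + c := by
  have : 1 + τ ≠ 0 := by linarith
  have : 1 - τ ≠ 0 := by linarith
  unfold ellipseGauge boundaryCurve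
  rw [mul_div_right_comm, mul_div_right_comm _ _ (1 - τ), mul_div_cancel_right₀ _ ‹1 + τ ≠ 0›,
    mul_div_cancel_right₀ _ ‹1 - τ ≠ 0›, mul_pow, mul_pow, ← mul_add, Real.cos_sq_add_sin_sq,
    Real.sq_sqrt (by linarith), mul_one]

theorem exists_boundaryCurve_eq (h0 : 0 ≤ τ) (h1 : τ < 1) (hc : 0 ≤ c) {z : ℂ}
    (hz : ellipseGauge τ z = 1 + c) : ∃ θ, boundaryCurve τ c θ = z := by
  have ha : 1 + τ ≠ 0 := by linarith
  have hb : 1 - τ ≠ 0 := by linarith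
  have hk : 0 < Real.sqrt (1 + c) := Real.sqrt_pos.2 (by linarith)
  have hk2 : Real.sqrt (1 + c) ^ 2 = 1 + c := Real.sq_sqrt (by linarith)
  set k := Real.sqrt (1 + c)
  set u : ℂ := ⟨z.re / (1 + τ) / k, z.im / (1 - τ) / k⟩ with hu
  have hn : ‖u‖ = 1 := by
    have : ‖u‖ ^ 2 = 1 := by
      rw [← Complex.normSq_eq_norm_sq, Complex.normSq_apply, hu, ← sq, ← sq, div_pow _ k,
        div_pow _ k, ← add_div, hk2, div_eq_one_iff_eq (by linarith)]
      exact hz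
    nlinarith [norm_nonneg u]
  have hu0 : u ≠ 0 := norm_pos_iff.1 (by rw [hn]; exact one_pos)
  refine ⟨Complex.arg u, Complex.ext ?_ ?_⟩
  · simp only [boundaryCurve]
    rw [Complex.cos_arg hu0, hn, hu]
    change k * (1 + τ) * (z.re / (1 + τ) / k / 1) = _
    field_simp
  · simp only [boundaryCurve]
    rw [Complex.sin_arg, hn, hu]
    change k * (1 - τ) * (z.im / (1 - τ) / k / 1) = _
    field_simp

/-- Near every boundary point of the ellipse there are boundary points outside the disc: otherwise,
by analyticity, the whole ellipse would lie on the circle, which is too small. -/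
theorem exists_boundary_notMem_disc (h0 : 0 ≤ τ) (h1 : τ < 1) (hc : 0 ≤ c)
    (hsub : discRegion τ c p ⊆ ellipseRegion τ c) {z : ℂ} (hz : ellipseGauge τ z = 1 + c)
    {U : Set ℂ} (hU : U ∈ 𝓝 z) : ∃ w ∈ U, ellipseGauge τ w = 1 + c ∧ w ∉ discRegion τ c p := by
  by_contra! hcon
  obtain ⟨θ₀, rfl⟩ := exists_boundaryCurve_eq h0 h1 hc hz
  set k := Real.sqrt (1 + c) with hk
  have hk2 : k ^ 2 = 1 + c := Real.sq_sqrt (by linarith)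
  set d : ℝ → ℝ := fun θ => (k * (1 + τ) * Real.cos θ - p.re) ^ 2
    + (k * (1 - τ) * Real.sin θ - p.im) ^ 2 - (1 - τ ^ 2) * c with hd
  have hnonneg : ∀ θ, 0 ≤ d θ := by
    intro θ
    by_contra! hlt
    have hint : boundaryCurve τ c θ ∈ interior (discRegion τ c p) := by
      rw [interior_discRegion h0 h1 hc, Metric.mem_ball, dist_eq_norm,
        ← sq_lt_sq₀ (norm_nonneg _) discRadius_nonneg, sq_discRadius h0 h1 hc,
        ← Complex.normSq_eq_norm_sq, Complex.normSq_apply, Complex.sub_re, Complex.sub_im, ← sq,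
        ← sq]
      simp only [hd] at hlt
      simp only [boundaryCurve]
      linarith
    -- a boundary point in the open disc could be pushed outwards inside the ellipse
    have hlim : Tendsto (fun t : ℝ => (t : ℂ) * boundaryCurve τ c θ) (𝓝[>] 1)
        (𝓝 (boundaryCurve τ c θ)) := by
      have : Continuous fun t : ℝ => (t : ℂ) * boundaryCurve τ c θ := by fun_prop
      have := this.tendsto 1
      rw [Complex.ofReal_one, one_mul] at this
      exact this.mono_left nhdsWithin_le_nhds
    obtain ⟨t, ht, ht1⟩ := ((hlim.eventually (isOpen_interior.mem_nhds hint)).and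
      self_mem_nhdsWithin).exists
    have hmem : ellipseGauge τ (t * boundaryCurve τ c θ) ≤ 1 + c := hsub (interior_subset ht)
    rw [ellipseGauge_smul, ellipseGauge_boundaryCurve h0 h1 hc] at hmem
    have ht1 : 1 < t := ht1
    have : 1 < t ^ 2 := by nlinarith
    nlinarith
  have hev : d =ᶠ[𝓝 θ₀] 0 := by
    filter_upwards [(continuous_boundaryCurve τ c).continuousAt.preimage_mem_nhds hU] with θ hθ
    have := hcon _ hθ (ellipseGauge_boundaryCurve h0 h1 hc θ)
    refine le_antisymm ?_ (hnonneg θ)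
    have hle : (boundaryCurve τ c θ).re ^ 2 - 2 * (boundaryCurve τ c θ).re * p.re + p.re ^ 2
        + ((boundaryCurve τ c θ).im ^ 2 - 2 * (boundaryCurve τ c θ).im * p.im + p.im ^ 2)
        ≤ (1 - τ ^ 2) * c := by
      have h : ((boundaryCurve τ c θ).re - p.re) ^ 2 + ((boundaryCurve τ c θ).im - p.im) ^ 2
        ≤ (1 - τ ^ 2) * c := this
      linarith
    simp only [boundaryCurve] at hle
    simp only [hd, Pi.zero_apply]
    linarith
  have han : AnalyticOnNhd ℝ d Set.univ := fun θ _ => by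
    simp only [hd]
    fun_prop
  have hall := han.eqOn_zero_of_preconnected_of_eventuallyEq_zero isPreconnected_univ
    (Set.mem_univ θ₀) hev
  -- the angles `0` and `π` show that the diameter of the disc is at least the major axis
  have e1 : d 0 = 0 := hall (Set.mem_univ 0)
  have e2 : d Real.pi = 0 := hall (Set.mem_univ Real.pi)
  simp only [hd, Real.cos_zero, Real.sin_zero, Real.cos_pi, Real.sin_pi] at e1 e2
  have e3 : (1 + c) * (1 + τ) ^ 2 + p.re ^ 2 + p.im ^ 2 = (1 - τ ^ 2) * c := by
    rw [← hk2]; linarith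
  nlinarith [sq_nonneg p.re, sq_nonneg p.im, mul_nonneg hc h0, mul_nonneg hc (sq_nonneg τ)]

theorem ellipseGauge_lt_subset_ellipseRegion :
    {w | ellipseGauge τ w < 1 + c} ⊆ ellipseRegion τ c := by
  intro w hw
  have hw : ellipseGauge τ w < 1 + c := hw
  exact hw.le

theorem exists_isOpen_subset_droplet_of_notMem {z : ℂ} (hz : ellipseGauge τ z ≤ 1 + c)
    (hc : 0 ≤ c) (h0 : 0 ≤ τ) (h1 : τ < 1) (hzD : z ∉ discRegion τ c p) {U : Set ℂ}
    (hU : U ∈ 𝓝 z) : ∃ V, IsOpen V ∧ V.Nonempty ∧ V ⊆ U ∧ V ⊆ droplet τ c p := by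
  have hDc : (discRegion τ c p)ᶜ ∈ 𝓝 z := by
    rw [discRegion_eq h0 h1 hc] at hzD ⊢
    exact Metric.isClosed_closedBall.isOpen_compl.mem_nhds hzD
  obtain ⟨W, hWs, hWo, hzW⟩ := mem_nhds_iff.1 (inter_mem hU hDc)
  have hlim : Tendsto (fun t : ℝ => (t : ℂ) * z) (𝓝[<] 1) (𝓝 z) := by
    have : Continuous fun t : ℝ => (t : ℂ) * z := by fun_prop
    have := this.tendsto 1
    rw [Complex.ofReal_one, one_mul] at this
    exact this.mono_left nhdsWithin_le_nhds
  obtain ⟨t, ht, ht0, ht1⟩ := ((hlim.eventually (hWo.mem_nhds hzW)).and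
    (Ioo_mem_nhdsLT (zero_lt_one' ℝ))).exists
  refine ⟨W ∩ {w | ellipseGauge τ w < 1 + c},
    hWo.inter (isOpen_lt (continuous_ellipseGauge τ) continuous_const), ⟨_, ht, ?_⟩,
    fun w hw => (hWs hw.1).1, fun w hw =>
      ⟨ellipseGauge_lt_subset_ellipseRegion hw.2, fun h => (hWs hw.1).2 (interior_subset h)⟩⟩
  change ellipseGauge τ (t * z) < 1 + c
  rw [ellipseGauge_smul]
  have : t ^ 2 < 1 := by nlinarith
  nlinarith

/-- Every point of the droplet is a limit of interior points. The delicate case is a point where the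
disc touches the boundary of the ellipse from inside. -/
theorem exists_isOpen_subset_droplet (h0 : 0 ≤ τ) (h1 : τ < 1) (hc : 0 ≤ c)
    (hsub : discRegion τ c p ⊆ ellipseRegion τ c) {z : ℂ} (hz : z ∈ droplet τ c p) {U : Set ℂ}
    (hU : U ∈ 𝓝 z) : ∃ V, IsOpen V ∧ V.Nonempty ∧ V ⊆ U ∧ V ⊆ droplet τ c p := by
  have hzE : ellipseGauge τ z ≤ 1 + c := hz.1
  rcases hzE.lt_or_eq with hlt | heq
  · have hW : interior U ∩ {w | ellipseGauge τ w < 1 + c} ∈ 𝓝 z :=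
      inter_mem (interior_mem_nhds.2 hU)
        ((isOpen_lt (continuous_ellipseGauge τ) continuous_const).mem_nhds hlt)
    have hcl : z ∈ closure (discRegion τ c p)ᶜ := by
      rw [closure_compl]; exact hz.2
    refine ⟨(interior U ∩ {w | ellipseGauge τ w < 1 + c}) ∩ (discRegion τ c p)ᶜ, ?_,
      mem_closure_iff_nhds.1 hcl _ hW, fun w hw => interior_subset hw.1.1,
      fun w hw => ⟨ellipseGauge_lt_subset_ellipseRegion hw.1.2, fun h => hw.2 (interior_subset h)⟩⟩
    rw [discRegion_eq h0 h1 hc]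
    exact (isOpen_interior.inter (isOpen_lt (continuous_ellipseGauge τ) continuous_const)).inter
      Metric.isClosed_closedBall.isOpen_compl
  · obtain ⟨w, hwU, hwE, hwD⟩ :=
      exists_boundary_notMem_disc h0 h1 hc hsub heq (interior_mem_nhds.2 hU)
    exact exists_isOpen_subset_droplet_of_notMem hwE.le hc h0 h1 hwD
      (mem_interior_iff_mem_nhds.1 hwU)

theorem support_dropletMeasure (h0 : 0 ≤ τ) (h1 : τ < 1) (hc : 0 ≤ c)
    (hsub : discRegion τ c p ⊆ ellipseRegion τ c) :
    (dropletMeasure τ c p).support = droplet τ c p := by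
  refine (Measure.support_subset_of_isClosed (isCompact_droplet h0 h1 hc).isClosed
    (ae_mem_droplet h0 h1 hc)).antisymm fun z hz => ?_
  rw [Measure.mem_support_iff_forall]
  intro U hU
  obtain ⟨V, hVo, hVn, hVU, hVS⟩ := exists_isOpen_subset_droplet h0 h1 hc hsub hz hU
  refine lt_of_lt_of_le ?_ (measure_mono hVU)
  rw [dropletMeasure, Measure.smul_apply, smul_eq_mul, Measure.restrict_apply hVo.measurableSet,
    Set.inter_eq_left.2 hVS]
  have : 0 < 1 - τ ^ 2 := by nlinarith
  have := Real.pi_pos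
  exact ENNReal.mul_pos (ENNReal.ofReal_pos.2 (by positivity)).ne' (hVo.measure_pos volume hVn).ne'

end

end PointCharge

end

theorem proposition2p1 (τ c : ℝ) (p : ℂ) (hτ0 : 0 ≤ τ) (hτ1 : τ < 1) (hc : 0 ≤ c)
    (hsub : PointCharge.discRegion τ c p ⊆ PointCharge.ellipseRegion τ c) :
    PointCharge.IsDroplet (PointCharge.potential τ c p)
      (PointCharge.ellipseRegion τ c ∩ (interior (PointCharge.discRegion τ c p))ᶜ) := by
  have hμ := PointCharge.isAdmissible_dropletMeasure hτ0 hτ1 hc hsub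
  have huniq : ∀ ν, PointCharge.IsEquilibriumMeasure (PointCharge.potential τ c p) ν →
      ν = PointCharge.dropletMeasure τ c p := fun ν hν =>
    (PointCharge.weightedEnergy_dropletMeasure_le hτ0 hτ1 hc hsub hν.1).2 (hν.2 _ hμ)
  refine ⟨⟨PointCharge.dropletMeasure τ c p, ⟨hμ, fun ν hν =>
    (PointCharge.weightedEnergy_dropletMeasure_le hτ0 hτ1 hc hsub hν).1⟩, huniq⟩, fun ν hν => ?_⟩
  rw [huniq ν hν]
  exact PointCharge.support_dropletMeasure hτ0 hτ1 hc hsub
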